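/- Let $h_1>2c>0$, and let $u=(u_j)_{j\in\mathbb Z}$ be the solution, in the class of sequences growing at most exponentially in $|j|$ locally uniformly in time, of $$\dot u_j=u_{j+1}-2u_j+u_{j-1}+\mathcal H(u_j),\quad t>0,\qquad u_j(0)=-cj^2,\quad j\in\mathbb Z ,$$ where $\mathcal H(w)(t)=h_1$ if $w(s)<0$ for all $s\in[0,t]$ and $\mathcal H(w)(t)=0$ otherwise (the equation may fail at finitely many times of each bounded interval). The switching moment of a node $u_j$ is the first time $t\ge 0$ at which $u_j$ reaches $0$. Let $a>0$ be the root, depending only on $h_1/c$, of $$\int_{-1}^1\frac{1}{\sqrt{4\pi a(1-x^2)}}\exp\Bigl(-\frac{1-x}{4a(1+x)}\Bigr)\,dx=\frac{h_1-2c}{h_1},$$ and let $E>0$. Then there is $n_0=n_0(E,h_1,c)\in\mathbb N$ such that the following holds for every $n\ge n_0+1$. Inductive hypothesis: the nodes $u_0,\dots,u_{n-1}$ switch at moments $t_0,\dots,t_{n-1}$ with $|t_k-ak^2|\le E\sqrt k$ for $k<n$, and $u_j<0$ on $[0,t_{n-1}]$ for all $j\ge n$. Let $v=(v_j)_{j\in\mathbb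 Z}$ be the solution (in the same growth class) of the problem with frozen hysteresis, $\dot v_j=v_{j+1}-2v_j+v_{j-1}+\mathcal H(u_j)(t_{n-1})$ for $t>t_{n-1}$, with $v_j(t_{n-1})=u_j(t_{n-1})$. Under the inductive hypothesis there is a root $t_n>t_{n-1}$ of $v_n$ with $|t_n-an^2|\le E\sqrt n$, and every such root $t_n$ satisfies: $v_n(t)<0$ for all $t\in(t_{n-1},t_n)$, so that $t_n$ is the first time after $t_{n-1}$ at which $v_n$ reaches the threshold $0$. Moreover, there is $s\in(t_{n-1},t_n)$ such that $(s-t_{n-1})\,\dot v_n(t)<\tfrac38h_1$ for $t\in(t_{n-1},s]$ and $\ddot v_n(t)\ge 0$ for $t\in[s,t_n]$. The number $n_0$ can be chosen so that, in addition, the statements about $t_n$ in the last paragraph, apart from the existence of $t_n$, hold whenever the switching times are prescribed: for any $t_0,\dots,t_{n-1}$ with $|t_k-ak^2|\le E\sqrt k$ and $0\le t_k\le t_{n-1}$ for all $k<n$, with $u$ replaced by a solution on $[0,t_{n-1}]$ (in the same growth class, with the equation allowed to fail at finitely many times) of the problem in which $\mathcal H(u_j)(t)$ is replaced by $0$ if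 $|j|<n$ and $t\ge t_{|j|}$ and by $h_1$ otherwise, provided that $u_{n-1}(t_{n-1})=0$, and with $v$ solving the problem with frozen values $0$ for $|j|<n$ and $h_1$ for $|j|\ge n$. -/

import Mathlib

open Set

noncomputable section

namespace Rattling

/-- The discrete Laplacian `w_{j+1} - 2 w_j + w_{j-1}` on `ℤ`, at time `t`. -/
def latticeLaplacian (w : ℤ → ℝ → ℝ) (j : ℤ) (t : ℝ) : ℝ :=
  w (j + 1) t - 2 * w j t + w (j - 1) t

open Classical in
/-- The hysteresis operator with thresholds `-∞` and `0` and with the values `h₁` and `0`, applied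
to the input `w` on `[0, ∞)`: the output is `h₁` as long as the input has stayed below the
threshold `0`, and it is `0` from the moment at which the input reaches the threshold. -/
def hysteresis (h₁ : ℝ) (w : ℝ → ℝ) (t : ℝ) : ℝ :=
  if ∀ s ∈ Icc 0 t, w s < 0 then h₁ else 0

/-- `w` solves `dw_j/dt = w_{j+1} - 2 w_j + w_{j-1} + F_j(t)`, `j ∈ ℤ`, on `(t₀, t₁)` except at the
times in `S`; every `w_j` is continuous on `[t₀, t₁]`, and `w_j` grows at most exponentially
in `|j|`, uniformly on `[t₀, t₁]` (the class in which the problem is well posed). -/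
structure SolvesLattice (F : ℤ → ℝ → ℝ) (S : Finset ℝ) (t₀ t₁ : ℝ) (w : ℤ → ℝ → ℝ) : Prop where
  continuousOn : ∀ j, ContinuousOn (w j) (Icc t₀ t₁)
  growth : ∃ A α : ℝ, ∀ j, ∀ t ∈ Icc t₀ t₁, |w j t| ≤ A * Real.exp (α * |(j : ℝ)|)
  hasDerivAt : ∀ t ∈ Ioo t₀ t₁, t ∉ S →
    ∀ j, HasDerivAt (w j) (latticeLaplacian w j t + F j t) t

/-- `u` is a solution, for all times, of `du_j/dt = Δu_j + ℋ(u_j)`, `u_j(0) = -c j²`, `j ∈ ℤ`.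
The equation may fail at finitely many times of each bounded interval (at a switching moment the
right-hand side jumps). -/
structure IsHysteresisSolution (c h₁ : ℝ) (u : ℤ → ℝ → ℝ) : Prop where
  initial : ∀ j : ℤ, u j 0 = -c * (j : ℝ) ^ 2
  solves : ∀ T > 0, ∃ S : Finset ℝ,
    SolvesLattice (fun j t => hysteresis h₁ (u j) t) S 0 T u

/-- The switching moment of a node: the first time in `[0, ∞)` at which it reaches the
threshold `0`. -/
def IsSwitchingMoment (w : ℝ → ℝ) (s : ℝ) : Prop :=
  IsLeast {r | 0 ≤ r ∧ 0 ≤ w r} s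

/-- The inductive hypothesis: the nodes `0, …, n - 1` of `u` switch at the moments
`t 0, …, t (n - 1)`, these satisfy `|t k - a k²| ≤ E √k`, and no node `j ≥ n` has
switched by the time `t (n - 1)`. -/
structure InductiveHypothesis (a E : ℝ) (u : ℤ → ℝ → ℝ) (t : ℕ → ℝ) (n : ℕ) : Prop where
  switch : ∀ k < n, IsSwitchingMoment (u k) (t k)
  near : ∀ k < n, |t k - a * (k : ℝ) ^ 2| ≤ E * √(k : ℝ)
  later : ∀ j : ℕ, n ≤ j → ∀ s ∈ Icc 0 (t (n - 1)), u j s < 0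

/-- `v` continues `u` from the time `t₀` on under the frozen hysteresis configuration `H`:
`dv_j/dt = Δv_j + H_j` for `t > t₀` and `v_j(t₀) = u_j(t₀)`, `j ∈ ℤ`. -/
structure IsFrozenContinuation (H : ℤ → ℝ) (t₀ : ℝ) (u v : ℤ → ℝ → ℝ) : Prop where
  initial : ∀ j, v j t₀ = u j t₀
  solves : ∀ T > t₀, SolvesLattice (fun j _ => H j) ∅ t₀ T v

/-- `s` is a candidate for the switching moment of the node `n`: a root after `t₀` of
`w = v_n`, of the form `s = a n² + q` with `|q| ≤ E √n`. -/
structure IsCandidate (a E : ℝ) (n : ℕ) (t₀ : ℝ) (w : ℝ → ℝ) (s : ℝ) : Prop where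
  after : t₀ < s
  near : |s - a * (n : ℝ) ^ 2| ≤ E * √(n : ℝ)
  root : w s = 0

/-- `w` does not reach the threshold `0` on `(t₀, t₁)`, and `t₁` is the first time after `t₀` at
which it does. More precisely, `(t₀, t₁)` splits at some `s` so that `w'` is on the first part too
small for `w` to rise by `3h₁/8` there, and `w'' ≥ 0` on the second part. -/
structure ReachesThresholdFirstAt (h₁ t₀ t₁ : ℝ) (w : ℝ → ℝ) : Prop where
  neg : ∀ t ∈ Ioo t₀ t₁, w t < 0
  first : IsLeast {t | t₀ < t ∧ 0 ≤ w t} t₁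
  split : ∃ s ∈ Ioo t₀ t₁,
    (∀ t ∈ Ioc t₀ s, deriv w t * (s - t₀) < 3 * h₁ / 8) ∧
    (∀ t ∈ Icc s t₁, 0 ≤ deriv (deriv w) t)

/-- The frozen configuration in which exactly the nodes `|j| < n` have switched. -/
def frozenConfig (h₁ : ℝ) (n : ℕ) (j : ℤ) : ℝ :=
  if j.natAbs < n then 0 else h₁

/-- The configuration in which the nodes `±k`, `k < n`, are switched at the prescribed
times `t k`, and no other node is switched. -/
def prescribedConfig (h₁ : ℝ) (n : ℕ) (t : ℕ → ℝ) (j : ℤ) (s : ℝ) : ℝ :=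
  open Classical in if j.natAbs < n ∧ t j.natAbs ≤ s then 0 else h₁

end Rattling

end

/-!
The front of switched nodes is described by an explicit solution. With prescribed switching times
`t k`, the solution of the lattice problem in its growth class is unique, and it equals
`-c j² + (h₁ - 2 c) s - h₁ ∑ f_{j-k}(s - t |k|)`, where `k` runs over the switched nodes and `f` is
the time integral of the heat kernel `G` of the lattice (`switchedSolution`,
`eq_switchedSolution`). Under the inductive hypothesis the solution with hysteresis is of this form,
with the switching times of `u` (`InductiveHypothesis.hysteresis_eq`), so the first claim about
`t_n` is a case of the second, apart from the existence of `t_n`. Write `N = n - 1`.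

* After `t_N` one has `v_n' = h₁ - 2 c - h₁ ∑ G_{n-k}(s - t |k|)`. The sum is a Riemann sum, whose
  limit is the integral in the equation for `a`. As `G ≥ 0`, Fatou's lemma bounds the sum from below
  by that integral up to a small error (`exists_integral_profile_sub_le_sum`), whatever the
  perturbation of the switching times, and so `v_n'` has a small upper bound on the interval
  `[t_N, t_N + τ₀]`, for every fixed length `τ₀`.
* After `t_N + τ₀` one has `v_n'' = -h₁ ∑ G'_{n-k}(s - t |k|) ≥ 0`, where `G'` is the time
  derivative. The gaps `t_N - t |k|` are at least of the order `N (N - |k|)`, so that for `k` close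
  to `N` the kernel has already passed its maximum at the node `n`, and the contribution is
  nonnegative. That of `k = N` is at least of the order `(s - t_N)^{-3/2}`, hence of the order
  `N^{-3/2}`, whereas all the remote nodes together contribute `O(N^{-2})`
  (`exists_sum_heatKernelLap_nonpos`).
* At the time `t_N` the node `n` is below the threshold by at least `7 h₁ / 16`
  (`exists_front_le`). The difference `u_n - u_N` is half the second difference plus half the
  symmetric difference of `u` at `N`. The latter leads to a sum over a monotone function, which is
  compared with an integral (`exists_sum_heatSource_sub_ge`), and `integral_slopeProfile` evaluates
  this integral: in the continuum limit the vanishing of the time derivative at the front, which is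
  the equation for `a`, implies that of the space derivative.

So `v_n` stays negative on `[t_N, t_N + τ₀]`, and it is convex from there on, so that it is negative
up to any of its roots (`exists_forall_reachesThresholdFirstAt`).

The existence of `t_n` rests on the uniqueness of the solution with hysteresis
(`IsHysteresisSolution.unique`): `u` is determined by `c` and `h₁`. Hence the inductive hypothesis
either holds for arbitrarily large `n`, and then the switching moment of the node `n` of `u` is the
required root of `v_n`, or it fails beyond some index, which `n₀` is allowed to exceed
(`exists_forall_isCandidate`).
-/

open Set

noncomputable section

namespace Rattling

open MeasureTheory Filter Topology Real intervalIntegral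

/-! ### The heat kernel of the lattice -/

/-- The symbol `2 - 2 cos θ` of the negative discrete Laplacian. -/
def symb (θ : ℝ) : ℝ := 2 - 2 * cos θ

/-- The fundamental solution of `dw_j/dt = w_{j+1} - 2 w_j + w_{j-1}`, as a Fourier integral. The
space variable is real, although only its integer values have a meaning on the lattice. -/
def heatKernel (x τ : ℝ) : ℝ := π⁻¹ * ∫ θ in (0 : ℝ)..π, cos (x * θ) * exp (-τ * symb θ)

/-- The discrete Laplacian in space of the heat kernel, which is also its time derivative. -/
def heatKernelLap (x τ : ℝ) : ℝ :=
  heatKernel (x + 1) τ - 2 * heatKernel x τ + heatKernel (x - 1) τ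

lemma symb_nonneg (θ : ℝ) : 0 ≤ symb θ := by
  unfold symb; linarith [cos_le_one θ]

lemma symb_le_four (θ : ℝ) : symb θ ≤ 4 := by
  unfold symb; linarith [neg_one_le_cos θ]

lemma symb_le_sq (θ : ℝ) : symb θ ≤ θ ^ 2 := by
  unfold symb; linarith [one_sub_sq_div_two_le_cos (x := θ)]

lemma sq_sub_symb_le (θ : ℝ) : θ ^ 2 - symb θ ≤ θ ^ 4 := by
  rcases le_total |θ| 1 with h | h
  · have := (abs_le.1 (cos_bound h)).2
    have h4 : |θ| ^ 4 = θ ^ 4 := by rw [← abs_pow, abs_of_nonneg (by positivity)]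
    rw [h4] at this
    unfold symb
    nlinarith [sq_nonneg (θ ^ 2)]
  · have h2 : 1 ≤ θ ^ 2 := by rw [← sq_abs]; nlinarith
    nlinarith [symb_nonneg θ]

lemma two_fifths_sq_le_symb {θ : ℝ} (h0 : 0 ≤ θ) (h1 : θ ≤ π) : 2 / 5 * θ ^ 2 ≤ symb θ := by
  have hs : symb θ = 4 * sin (θ / 2) ^ 2 := by
    have := cos_sq' (θ / 2)
    have h2 := cos_two_mul (θ / 2)
    rw [show 2 * (θ / 2) = θ by ring] at h2
    unfold symb; linarith
  have hj : 2 / π * (θ / 2) ≤ sin (θ / 2) := mul_le_sin (by linarith) (by linarith)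
  have hp : 0 ≤ 2 / π * (θ / 2) := by positivity
  have hsq := pow_le_pow_left₀ hp hj 2
  have hpi : π ^ 2 ≤ 10 := by nlinarith [pi_lt_d2, pi_pos]
  have h10 : 2 / 5 ≤ 4 / π ^ 2 := by
    rw [div_le_div_iff₀ (by norm_num) (by positivity)]; linarith
  rw [hs]
  calc 2 / 5 * θ ^ 2 ≤ 4 / π ^ 2 * θ ^ 2 := by gcongr
    _ = 4 * (2 / π * (θ / 2)) ^ 2 := by ring
    _ ≤ _ := by linarith

lemma continuous_symb : Continuous symb := by unfold symb; fun_prop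

lemma hasDerivAt_heatKernel (x τ : ℝ) :
    HasDerivAt (heatKernel x) (heatKernelLap x τ) τ := by
  have hc := continuous_symb
  have key := hasDerivAt_integral_of_dominated_loc_of_deriv_le (μ := volume)
    (F := fun τ θ => cos (x * θ) * exp (-τ * symb θ)) (a := 0) (b := π)
    (F' := fun τ θ => cos (x * θ) * (exp (-τ * symb θ) * (-symb θ))) (x₀ := τ)
    (s := Metric.ball τ 1) (bound := fun _ => exp (4 * (|τ| + 1)) * 4)
    (Metric.ball_mem_nhds _ one_pos)
    (Eventually.of_forall fun τ => Continuous.aestronglyMeasurable (by fun_prop))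
    (Continuous.intervalIntegrable (by fun_prop) _ _)
    (Continuous.aestronglyMeasurable (by fun_prop))
    (ae_of_all _ fun θ _ r hr => ?_) (by simp)
    (ae_of_all _ fun θ _ r _ => ?_)
  · refine (key.2.const_mul π⁻¹).congr_deriv ?_
    unfold heatKernelLap heatKernel
    rw [show ∀ A B C : ℝ, π⁻¹ * A - 2 * (π⁻¹ * B) + π⁻¹ * C = π⁻¹ * (A - 2 * B + C) by intros; ring]
    congr 1
    rw [← intervalIntegral.integral_const_mul,
      ← intervalIntegral.integral_sub (Continuous.intervalIntegrable (by fun_prop) _ _)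
        (Continuous.intervalIntegrable (by fun_prop) _ _),
      ← intervalIntegral.integral_add (Continuous.intervalIntegrable (by fun_prop) _ _)
        (Continuous.intervalIntegrable (by fun_prop) _ _)]
    refine integral_congr fun θ _ => ?_
    simp only [symb, add_mul, sub_mul, one_mul, cos_add, cos_sub]
    ring
  · have hr' : |r| ≤ |τ| + 1 := by
      have := abs_sub_abs_le_abs_sub r τ
      rw [Metric.mem_ball, Real.dist_eq] at hr
      linarith
    have h1 : -r * symb θ ≤ 4 * (|τ| + 1) := by
      nlinarith [symb_nonneg θ, symb_le_four θ, neg_abs_le r, abs_nonneg r]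
    rw [norm_mul, norm_mul, norm_neg, Real.norm_eq_abs, Real.norm_eq_abs, Real.norm_eq_abs,
      abs_of_nonneg (symb_nonneg θ), abs_of_pos (exp_pos _)]
    calc |cos (x * θ)| * (exp (-r * symb θ) * symb θ)
        ≤ 1 * (exp (4 * (|τ| + 1)) * 4) := by
          gcongr
          · exact mul_nonneg (exp_pos _).le (symb_nonneg θ)
          · exact abs_cos_le_one _
          · exact symb_nonneg θ
          · exact symb_le_four θ
      _ = _ := one_mul _
  · have h1 : HasDerivAt (fun r : ℝ => -r * symb θ) (-symb θ) r := by
      simpa using ((hasDerivAt_id r).neg.mul_const (symb θ))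
    exact (h1.exp.const_mul (cos (x * θ)))

lemma continuous_heatKernel (x : ℝ) : Continuous (heatKernel x) :=
  continuous_iff_continuousAt.2 fun τ => (hasDerivAt_heatKernel x τ).continuousAt

lemma heatKernel_neg (x τ : ℝ) : heatKernel (-x) τ = heatKernel x τ := by
  simp [heatKernel]

lemma abs_heatKernel_le_one (x : ℝ) {τ : ℝ} (hτ : 0 ≤ τ) : |heatKernel x τ| ≤ 1 := by
  have h := norm_integral_le_of_norm_le_const (a := 0) (b := π) (C := 1)
    (f := fun θ => cos (x * θ) * exp (-τ * symb θ)) fun θ _ => by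
      rw [norm_mul, Real.norm_eq_abs, Real.norm_eq_abs, abs_of_pos (exp_pos _)]
      have : exp (-τ * symb θ) ≤ 1 := exp_le_one_iff.2 (by nlinarith [symb_nonneg θ])
      nlinarith [abs_cos_le_one (x * θ), exp_pos (-τ * symb θ), abs_nonneg (cos (x * θ))]
  rw [Real.norm_eq_abs, sub_zero, abs_of_pos pi_pos, one_mul] at h
  rw [heatKernel, abs_mul, abs_of_pos (by positivity : 0 < π⁻¹)]
  calc π⁻¹ * _ ≤ π⁻¹ * π := by gcongr
    _ = 1 := inv_mul_cancel₀ pi_ne_zero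

lemma heatKernel_zero (m : ℤ) : heatKernel m 0 = if m = 0 then 1 else 0 := by
  unfold heatKernel
  split_ifs with h
  · simp [h]
  · have hm : (m : ℝ) ≠ 0 := by exact_mod_cast h
    have : ∫ θ in (0 : ℝ)..π, cos (m * θ) * exp (-0 * symb θ) = 0 := by
      simp only [neg_zero, zero_mul, exp_zero, mul_one]
      rw [integral_comp_mul_left (fun x => cos x) hm]
      simp
    rw [this, mul_zero]

/-- The rescaled kernel `e^{2τ} G_m(τ)` solves `P_m' = P_{m+1} + P_{m-1}` with nonnegative initial
values; Picard iteration improves any lower bound to `0`. -/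
lemma heatKernel_nonneg (m : ℤ) {τ : ℝ} (hτ : 0 ≤ τ) : 0 ≤ heatKernel m τ := by
  set P : ℤ → ℝ → ℝ := fun m s => exp (2 * s) * heatKernel m s
  have hP : ∀ m s, HasDerivAt (P m) (P (m + 1) s + P (m - 1) s) s := fun m s => by
    have h1 : HasDerivAt (fun s : ℝ => exp (2 * s)) (exp (2 * s) * 2) s := by
      simpa using ((hasDerivAt_id s).const_mul (2 : ℝ)).exp
    refine (h1.mul (hasDerivAt_heatKernel m s)).congr_deriv ?_
    simp only [P, heatKernelLap]
    push_cast
    ring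
  have hP0 : ∀ m, 0 ≤ P m 0 := fun m => by
    simp only [P, heatKernel_zero]
    split_ifs <;> simp
  have main : ∀ k : ℕ, ∀ m : ℤ, ∀ s ∈ Icc 0 τ,
      -(exp (2 * τ) * ((2 * s) ^ k / k.factorial)) ≤ P m s := by
    intro k
    induction k with
    | zero =>
      intro m s hs
      have h1 := (abs_le.1 (abs_heatKernel_le_one m hs.1)).1
      have h2 : exp (2 * s) ≤ exp (2 * τ) := exp_le_exp.2 (by linarith [hs.2])
      simp only [P, pow_zero, Nat.factorial_zero, Nat.cast_one, div_one, mul_one]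
      nlinarith [exp_pos (2 * s)]
    | succ k ih =>
      intro m s hs
      have hd : ∀ r, HasDerivAt
          (fun r => P m r + exp (2 * τ) * ((2 * r) ^ (k + 1) / (k + 1).factorial))
          (P (m + 1) r + P (m - 1) r + 2 * (exp (2 * τ) * ((2 * r) ^ k / k.factorial))) r := by
        intro r
        have h1 : HasDerivAt (fun r : ℝ => (2 * r) ^ (k + 1)) (((k + 1 : ℕ) : ℝ) * (2 * r) ^ k * 2) r := by
          simpa using ((hasDerivAt_id r).const_mul (2 : ℝ)).fun_pow (k + 1)
        refine ((hP m r).add ((h1.div_const _).const_mul _)).congr_deriv ?_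
        rw [Nat.factorial_succ]
        push_cast
        have := k.factorial_ne_zero
        field_simp
      have hmono : MonotoneOn
          (fun r => P m r + exp (2 * τ) * ((2 * r) ^ (k + 1) / (k + 1).factorial)) (Icc 0 τ) := by
        refine monotoneOn_of_deriv_nonneg (convex_Icc _ _)
          (fun r _ => (hd r).continuousAt.continuousWithinAt)
          (fun r _ => (hd r).differentiableAt.differentiableWithinAt) fun r hr => ?_
        rw [interior_Icc] at hr
        rw [(hd r).deriv]
        have h1 := ih (m + 1) r ⟨hr.1.le, hr.2.le⟩
        have h2 := ih (m - 1) r ⟨hr.1.le, hr.2.le⟩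
        linarith
      have := hmono (left_mem_Icc.2 hτ) hs hs.1
      simp only [mul_zero, ne_eq, Nat.succ_ne_zero, not_false_eq_true, zero_pow, zero_div,
        add_zero] at this
      linarith [hP0 m]
  have hlim : Tendsto (fun k : ℕ => -(exp (2 * τ) * ((2 * τ) ^ k / k.factorial))) atTop (𝓝 0) := by
    simpa using ((FloorSemiring.tendsto_pow_div_factorial_atTop (2 * τ)).const_mul
      (exp (2 * τ))).neg
  have hge : 0 ≤ P m τ := le_of_tendsto' hlim fun k => main k m τ (right_mem_Icc.2 hτ)
  exact nonneg_of_mul_nonneg_right hge (exp_pos _)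

/-- The response `∫₀^τ G_x` of the lattice to a unit source that acts since time `0`. -/
def heatSource (x τ : ℝ) : ℝ := ∫ s in (0 : ℝ)..τ, heatKernel x s

lemma hasDerivAt_heatSource (x τ : ℝ) : HasDerivAt (heatSource x) (heatKernel x τ) τ :=
  integral_hasDerivAt_right ((continuous_heatKernel x).intervalIntegrable _ _)
    ((continuous_heatKernel x).stronglyMeasurableAtFilter _ _)
    (continuous_heatKernel x).continuousAt

@[simp] lemma heatSource_zero (x : ℝ) : heatSource x 0 = 0 := by simp [heatSource]

lemma abs_heatSource_le (x : ℝ) {τ : ℝ} (hτ : 0 ≤ τ) : |heatSource x τ| ≤ τ := by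
  have h := norm_integral_le_of_norm_le_const (a := 0) (b := τ) (C := 1) (f := heatKernel x)
    fun s hs => by
      rw [uIoc_of_le hτ] at hs
      exact abs_heatKernel_le_one x hs.1.le
  simpa [heatSource, abs_of_nonneg hτ] using h

lemma heatSource_neg (x τ : ℝ) : heatSource (-x) τ = heatSource x τ := by
  simp [heatSource, heatKernel_neg]

lemma heatSource_laplacian (m : ℤ) (τ : ℝ) :
    heatSource (m + 1) τ - 2 * heatSource m τ + heatSource (m - 1) τ
      = heatKernel m τ - if m = 0 then 1 else 0 := by
  rw [← heatKernel_zero m]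
  have hi : ∀ x, IntervalIntegrable (heatKernel x) volume 0 τ := fun x =>
    (continuous_heatKernel x).intervalIntegrable _ _
  have := integral_eq_sub_of_hasDerivAt (a := 0) (b := τ)
    (fun s _ => hasDerivAt_heatKernel (m : ℝ) s)
    ((((hi _).sub ((hi _).const_mul 2)).add (hi _)))
  rw [← this]
  unfold heatSource heatKernelLap
  rw [intervalIntegral.integral_add ((hi _).sub ((hi _).const_mul 2)) (hi _),
    intervalIntegral.integral_sub (hi _) ((hi _).const_mul 2),
    intervalIntegral.integral_const_mul]

/-- The spatial increments of the source solution are partial masses of the heat kernel. -/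
lemma heatSource_succ_sub (m : ℕ) (τ : ℝ) :
    heatSource (m + 1) τ - heatSource m τ
      = -1 / 2 + heatKernel 0 τ / 2 + ∑ i ∈ Finset.range m, heatKernel (i + 1) τ := by
  induction m with
  | zero =>
    have h := heatSource_laplacian 0 τ
    have h' := heatSource_neg 1 τ
    simp only [Int.cast_zero, zero_add, zero_sub, if_true] at h
    simp only [Nat.cast_zero, zero_add, Finset.range_zero, Finset.sum_empty]
    linarith
  | succ m ih =>
    have h := heatSource_laplacian (m + 1) τ
    rw [if_neg (by positivity)] at h
    push_cast at h ⊢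
    rw [Finset.sum_range_succ]
    rw [show (m : ℝ) + 1 - 1 = m by ring] at h
    linarith

/-! ### Asymptotics of the heat kernel -/

/-- The heat kernel of the real line. -/
def gaussKernel (x τ : ℝ) : ℝ := exp (-x ^ 2 / (4 * τ)) / √(4 * π * τ)

lemma integrable_cos_mul_gaussian (x : ℝ) {τ : ℝ} (hτ : 0 < τ) :
    Integrable fun θ : ℝ => cos (x * θ) * exp (-τ * θ ^ 2) := by
  refine (integrable_exp_neg_mul_sq hτ).mono' (Continuous.aestronglyMeasurable (by fun_prop))
    (ae_of_all _ fun θ => ?_)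
  rw [norm_mul, Real.norm_eq_abs, Real.norm_eq_abs, abs_of_pos (exp_pos _)]
  exact mul_le_of_le_one_left (exp_pos _).le (abs_cos_le_one _)

lemma gaussKernel_eq_integral (x : ℝ) {τ : ℝ} (hτ : 0 < τ) :
    gaussKernel x τ = π⁻¹ * ∫ θ in Ioi (0 : ℝ), cos (x * θ) * exp (-τ * θ ^ 2) := by
  have h1 := fourierIntegral_gaussian (b := (τ : ℂ)) (by simpa using hτ) (x : ℂ)
  have hint : Integrable fun θ : ℝ =>
      Complex.exp (Complex.I * x * θ) * Complex.exp (-τ * (θ : ℂ) ^ 2) := by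
    refine (integrable_exp_neg_mul_sq hτ).mono' (Continuous.aestronglyMeasurable (by fun_prop))
      (ae_of_all _ fun θ => le_of_eq ?_)
    rw [norm_mul, show Complex.I * x * θ = ((x * θ : ℝ) : ℂ) * Complex.I by push_cast; ring,
      Complex.norm_exp_ofReal_mul_I, one_mul,
      show -(τ : ℂ) * (θ : ℂ) ^ 2 = ((-τ * θ ^ 2 : ℝ) : ℂ) by push_cast; ring,
      Complex.norm_exp_ofReal]
  have h2 := congrArg Complex.re h1
  rw [show (∫ θ : ℝ, Complex.exp (Complex.I * x * θ) * Complex.exp (-τ * (θ : ℂ) ^ 2)).re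
      = ∫ θ : ℝ, (Complex.exp (Complex.I * x * θ) * Complex.exp (-τ * (θ : ℂ) ^ 2)).re from
      (integral_re hint).symm] at h2
  have h3 : ∀ θ : ℝ, (Complex.exp (Complex.I * x * θ) * Complex.exp (-τ * (θ : ℂ) ^ 2)).re
      = cos (x * |θ|) * exp (-τ * |θ| ^ 2) := fun θ => by
    rw [show Complex.I * x * θ = ((x * θ : ℝ) : ℂ) * Complex.I by push_cast; ring,
      show -(τ : ℂ) * (θ : ℂ) ^ 2 = ((-τ * θ ^ 2 : ℝ) : ℂ) by push_cast; ring,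
      ← Complex.ofReal_exp, Complex.re_mul_ofReal, Complex.exp_ofReal_mul_I_re, sq_abs]
    congr 1
    rcases abs_cases θ with ⟨h, _⟩ | ⟨h, _⟩ <;> rw [h]
    rw [mul_neg, cos_neg]
  simp_rw [h3] at h2
  rw [integral_comp_abs (f := fun θ => cos (x * θ) * exp (-τ * θ ^ 2))] at h2
  have h4 : (π / τ : ℂ) ^ (1 / 2 : ℂ) * Complex.exp (-(x : ℂ) ^ 2 / (4 * τ))
      = ((√(π / τ) * exp (-x ^ 2 / (4 * τ)) : ℝ) : ℂ) := by
    rw [sqrt_eq_rpow, Complex.ofReal_mul, Complex.ofReal_cpow (by positivity)]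
    push_cast
    rfl
  rw [h4, Complex.ofReal_re] at h2
  have h5 : ∫ θ in Ioi (0 : ℝ), cos (x * θ) * exp (-τ * θ ^ 2)
      = √(π / τ) * exp (-x ^ 2 / (4 * τ)) / 2 := by linarith
  rw [h5, gaussKernel, sqrt_div pi_pos.le, sqrt_mul (by positivity), sqrt_mul (by positivity),
    show √(4 : ℝ) = 2 by rw [show (4 : ℝ) = 2 ^ 2 by norm_num]; exact sqrt_sq (by norm_num)]
  have h6 : √π * √π = π := mul_self_sqrt pi_pos.le
  have h7 : 0 < √π := sqrt_pos.2 pi_pos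
  have h8 : 0 < √τ := sqrt_pos.2 hτ
  field_simp
  linarith [sq_sqrt pi_pos.le]

lemma integrableOn_gaussian {τ : ℝ} (hτ : 0 < τ) (s : Set ℝ) :
    IntegrableOn (fun θ : ℝ => exp (-(τ / 5) * θ ^ 2)) s :=
  (integrable_exp_neg_mul_sq (by positivity)).integrableOn

lemma integral_gaussian_le {τ : ℝ} (hτ : 0 < τ) :
    ∫ θ in Ioi (0 : ℝ), exp (-(τ / 5) * θ ^ 2) ≤ 2 / √τ := by
  have h1 : √(5 * π) ≤ 4 := sqrt_le_iff.2 ⟨by norm_num, by linarith [pi_lt_d2]⟩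
  have h2 : 0 < √τ := sqrt_pos.2 hτ
  rw [integral_gaussian_Ioi, show π / (τ / 5) = (5 * π) / τ by field_simp,
    sqrt_div (by positivity), div_div, div_le_div_iff₀ (by positivity) h2]
  nlinarith

/-- Bounds for Fourier integrals whose integrand is dominated by a Gaussian. -/
lemma abs_integral_le_of_gaussian {f : ℝ → ℝ} {K τ : ℝ} (hτ : 0 < τ) (hK : 0 ≤ K)
    (h : ∀ θ, 0 ≤ θ → θ ≤ π → |f θ| ≤ K * exp (-(τ / 5) * θ ^ 2)) :
    |∫ θ in (0 : ℝ)..π, f θ| ≤ 2 * K / √τ := by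
  rw [integral_of_le pi_pos.le]
  have h1 : ‖∫ θ in Ioc 0 π, f θ‖ ≤ ∫ θ in Ioc 0 π, K * exp (-(τ / 5) * θ ^ 2) :=
    norm_integral_le_of_norm_le ((integrableOn_gaussian hτ _).const_mul K)
      ((ae_restrict_iff' measurableSet_Ioc).2 (ae_of_all _ fun θ hθ => h θ hθ.1.le hθ.2))
  have h2 : ∫ θ in Ioc 0 π, K * exp (-(τ / 5) * θ ^ 2)
      ≤ ∫ θ in Ioi (0 : ℝ), K * exp (-(τ / 5) * θ ^ 2) :=
    setIntegral_mono_set ((integrableOn_gaussian hτ _).const_mul K)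
      (ae_of_all _ fun θ => by positivity) (LE.le.eventuallyLE fun θ hθ => hθ.1)
  simp only [MeasureTheory.integral_const_mul] at h1 h2
  calc _ ≤ _ := h1.trans h2
    _ ≤ K * (2 / √τ) := by gcongr; exact integral_gaussian_le hτ
    _ = _ := by ring

lemma exp_symb_le {τ θ : ℝ} (hτ : 0 ≤ τ) (h0 : 0 ≤ θ) (h1 : θ ≤ π) :
    exp (-τ * symb θ) ≤ exp (-(τ / 5) * θ ^ 2) * exp (-(τ / 5) * θ ^ 2) := by
  rw [← exp_add]
  refine exp_le_exp.2 ?_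
  nlinarith [mul_le_mul_of_nonneg_left (two_fifths_sq_le_symb h0 h1) hτ]

lemma mul_exp_le (y : ℝ) : y * exp (-y / 5) ≤ 5 := by
  have h := add_one_le_exp (y / 5)
  rw [neg_div, exp_neg, ← div_eq_mul_inv, div_le_iff₀ (exp_pos _)]
  linarith

lemma sq_mul_exp_le {y : ℝ} (hy : 0 ≤ y) : y ^ 2 * exp (-y / 5) ≤ 50 := by
  have h := quadratic_le_exp_of_nonneg (x := y / 5) (by positivity)
  rw [neg_div, exp_neg, ← div_eq_mul_inv, div_le_iff₀ (exp_pos _)]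
  nlinarith

lemma abs_exp_symb_sub_le {τ θ : ℝ} (hτ : 0 < τ) (h0 : 0 ≤ θ) (h1 : θ ≤ π) :
    |exp (-τ * symb θ) - exp (-τ * θ ^ 2)| ≤ 50 / τ * exp (-(τ / 5) * θ ^ 2) := by
  have ha : exp (-τ * θ ^ 2) ≤ exp (-τ * symb θ) :=
    exp_le_exp.2 (by nlinarith [symb_le_sq θ])
  rw [abs_of_nonneg (by linarith)]
  have hb : exp (-τ * symb θ) - exp (-τ * θ ^ 2) ≤ exp (-τ * symb θ) * (τ * θ ^ 4) := by
    have := add_one_le_exp (-τ * θ ^ 2 - -τ * symb θ)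
    rw [exp_sub, le_div_iff₀ (exp_pos _)] at this
    nlinarith [exp_pos (-τ * symb θ), mul_le_mul_of_nonneg_left (sq_sub_symb_le θ)
      (mul_pos hτ (exp_pos (-τ * symb θ))).le]
  have hc := exp_symb_le hτ.le h0 h1
  have hd := sq_mul_exp_le (y := τ * θ ^ 2) (by positivity)
  rw [show -(τ * θ ^ 2) / 5 = -(τ / 5) * θ ^ 2 by ring] at hd
  set e := exp (-(τ / 5) * θ ^ 2)
  have he : 0 < e := exp_pos _
  calc _ ≤ exp (-τ * symb θ) * (τ * θ ^ 4) := hb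
    _ ≤ e * e * (τ * θ ^ 4) := by gcongr
    _ = ((τ * θ ^ 2) ^ 2 * e) / τ * e := by field_simp
    _ ≤ 50 / τ * e := by gcongr

/-- The local limit theorem: lattice and continuum heat kernels differ by `O(τ^{-3/2})`,
uniformly in space. -/
lemma abs_heatKernel_sub_gaussKernel_le (x : ℝ) {τ : ℝ} (hτ : 0 < τ) :
    |heatKernel x τ - gaussKernel x τ| ≤ 100 / (τ * √τ) := by
  have hi1 : IntegrableOn (fun θ => cos (x * θ) * exp (-τ * symb θ)) (Ioc 0 π) := by
    have hc := continuous_symb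
    exact (Continuous.integrableOn_Ioc (by fun_prop))
  have hi2 := (integrable_cos_mul_gaussian x hτ).integrableOn (s := Ioi 0)
  rw [gaussKernel_eq_integral x hτ, heatKernel, integral_of_le pi_pos.le, ← mul_sub,
    ← inter_eq_self_of_subset_right (Ioc_subset_Ioi_self : Ioc (0 : ℝ) π ⊆ Ioi 0),
    ← setIntegral_indicator measurableSet_Ioc, ← MeasureTheory.integral_sub
    ((integrable_indicator_iff measurableSet_Ioc).2 (hi1.mono_measure Measure.restrict_le_self)) hi2,
    abs_mul, abs_of_pos (by positivity)]
  have hb : ‖∫ θ in Ioi (0 : ℝ), ((Ioc 0 π).indicator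
      (fun θ => cos (x * θ) * exp (-τ * symb θ)) θ - cos (x * θ) * exp (-τ * θ ^ 2))‖
      ≤ ∫ θ in Ioi (0 : ℝ), 50 / τ * exp (-(τ / 5) * θ ^ 2) := by
    refine norm_integral_le_of_norm_le ((integrableOn_gaussian hτ _).const_mul _)
      ((ae_restrict_iff' measurableSet_Ioi).2 (ae_of_all _ fun θ (hθ : 0 < θ) => ?_))
    rw [Real.norm_eq_abs]
    by_cases h : θ ≤ π
    · rw [indicator_of_mem (show θ ∈ Ioc 0 π from ⟨hθ, h⟩), ← mul_sub, abs_mul]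
      have := abs_exp_symb_sub_le hτ hθ.le h
      nlinarith [abs_cos_le_one (x * θ), abs_nonneg (cos (x * θ)),
        abs_nonneg (exp (-τ * symb θ) - exp (-τ * θ ^ 2))]
    · rw [indicator_of_notMem (fun h' : θ ∈ Ioc 0 π => h h'.2), zero_sub, abs_neg, abs_mul,
        abs_of_pos (exp_pos _)]
      have hθ1 : 1 ≤ θ := by linarith [pi_gt_three]
      have h1 : exp (-τ * θ ^ 2) ≤ exp (-(τ / 5) * θ ^ 2) * exp (-(τ / 5) * θ ^ 2) := by
        rw [← exp_add]
        exact exp_le_exp.2 (by nlinarith [mul_nonneg hτ.le (sq_nonneg θ)])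
      have h2 := mul_exp_le (τ * θ ^ 2)
      rw [show -(τ * θ ^ 2) / 5 = -(τ / 5) * θ ^ 2 by ring] at h2
      have h3 : exp (-(τ / 5) * θ ^ 2) ≤ 50 / τ := by
        rw [le_div_iff₀ hτ]
        have : τ * exp (-(τ / 5) * θ ^ 2) ≤ τ * θ ^ 2 * exp (-(τ / 5) * θ ^ 2) := by
          gcongr
          exact le_mul_of_one_le_right hτ.le (by nlinarith)
        linarith
      calc |cos (x * θ)| * exp (-τ * θ ^ 2) ≤ 1 * exp (-τ * θ ^ 2) := by
            gcongr; exact abs_cos_le_one _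
        _ ≤ _ := by rw [one_mul]; exact h1.trans (by gcongr)
  rw [MeasureTheory.integral_const_mul] at hb
  have hpi : π⁻¹ ≤ 1 := inv_le_one_of_one_le₀ (by linarith [pi_gt_three])
  calc _ ≤ 1 * (50 / τ * (2 / √τ)) := by
        gcongr
        refine hb.trans ?_
        gcongr
        exact integral_gaussian_le hτ
    _ = _ := by field_simp; norm_num

/-- Time derivative of the spatial increments `(y_{x+1} - y_{x-1}) / 2` of the source solution. -/
lemma abs_heatKernel_sub_le (x : ℝ) {τ : ℝ} (hτ : 0 < τ) :
    |heatKernel (x + 1) τ - heatKernel (x - 1) τ| ≤ 8 / τ := by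
  have hc := continuous_symb
  rw [heatKernel, heatKernel, ← mul_sub,
    ← intervalIntegral.integral_sub (Continuous.intervalIntegrable (by fun_prop) _ _)
        (Continuous.intervalIntegrable (by fun_prop) _ _), abs_mul, abs_of_pos (by positivity)]
  have hst : 0 < √τ := sqrt_pos.2 hτ
  have hsq : √τ ^ 2 = τ := sq_sqrt hτ.le
  have h := abs_integral_le_of_gaussian (K := 4 / √τ) hτ (by positivity)
    (f := fun θ => cos ((x + 1) * θ) * exp (-τ * symb θ) - cos ((x - 1) * θ) * exp (-τ * symb θ))
    fun θ h0 h1 => by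
      have e1 : cos ((x + 1) * θ) * exp (-τ * symb θ) - cos ((x - 1) * θ) * exp (-τ * symb θ)
          = -2 * sin (x * θ) * sin θ * exp (-τ * symb θ) := by
        rw [add_mul, sub_mul, one_mul, cos_add, cos_sub]; ring
      rw [e1, abs_mul, abs_mul, abs_mul, abs_of_pos (exp_pos _)]
      have e2 : |sin θ| ≤ θ := by simpa [abs_of_nonneg h0] using abs_sin_le_abs (x := θ)
      have e3 := exp_symb_le hτ.le h0 h1
      have e4 : θ * exp (-(τ / 5) * θ ^ 2) ≤ 2 / √τ := by
        rw [le_div_iff₀ hst, neg_mul, exp_neg, mul_right_comm, ← div_eq_mul_inv,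
          div_le_iff₀ (exp_pos _)]
        have := add_one_le_exp (τ / 5 * θ ^ 2)
        nlinarith [sq_nonneg (√τ * θ - 2)]
      set e := exp (-(τ / 5) * θ ^ 2)
      have he : 0 < e := exp_pos _
      calc |(-2 : ℝ)| * |sin (x * θ)| * |sin θ| * exp (-τ * symb θ)
          ≤ 2 * 1 * θ * (e * e) := by
            gcongr
            · norm_num
            · exact abs_sin_le_one _
        _ = 2 * (θ * e) * e := by ring
        _ ≤ 2 * (2 / √τ) * e := by gcongr
        _ = 4 / √τ * e := by ring
  have hpi : π⁻¹ ≤ 1 := inv_le_one_of_one_le₀ (by linarith [pi_gt_three])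
  calc _ ≤ 1 * (2 * (4 / √τ) / √τ) := by gcongr
    _ = _ := by rw [← hsq, sqrt_sq hst.le]; field_simp; norm_num

lemma heatKernelLap_eq_integral (x τ : ℝ) :
    heatKernelLap x τ = -(π⁻¹ * ∫ θ in (0 : ℝ)..π, symb θ * exp (-τ * symb θ) * cos (x * θ)) := by
  have hc := continuous_symb
  unfold heatKernelLap heatKernel
  rw [show ∀ A B C : ℝ, π⁻¹ * A - 2 * (π⁻¹ * B) + π⁻¹ * C = π⁻¹ * (A - 2 * B + C) by intros; ring,
    ← mul_neg]
  congr 1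
  rw [← intervalIntegral.integral_const_mul,
    ← intervalIntegral.integral_sub (Continuous.intervalIntegrable (by fun_prop) _ _)
      (Continuous.intervalIntegrable (by fun_prop) _ _),
    ← intervalIntegral.integral_add (Continuous.intervalIntegrable (by fun_prop) _ _)
      (Continuous.intervalIntegrable (by fun_prop) _ _), ← intervalIntegral.integral_neg]
  refine integral_congr fun θ _ => ?_
  simp only [symb, add_mul, sub_mul, one_mul, cos_add, cos_sub]
  ring

/-- At a fixed node the heat kernel decreases from a time on that is proportional to the squared
distance from the source; its slope is then at least of the order `τ^{-3/2}`. -/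
lemma exists_heatKernelLap_le :
    ∃ κ > 0, ∃ ρ ≥ 1, ∀ x τ : ℝ, 1 ≤ τ → ρ * x ^ 2 ≤ τ →
      heatKernelLap x τ ≤ -(κ / (τ * √τ)) := by
  have hc := continuous_symb
  -- the weight of the low frequencies `θ ≤ τ^{-1/2}`
  have hA : ∀ τ : ℝ, 1 ≤ τ →
      2 / 15 * exp (-1) / (τ * √τ) ≤ ∫ θ in (0 : ℝ)..π, symb θ * exp (-τ * symb θ) := by
    intro τ hτ
    have hτ0 : 0 < τ := by linarith
    have hst : 1 ≤ √τ := one_le_sqrt.2 hτ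
    have hsq : √τ ^ 2 = τ := sq_sqrt hτ0.le
    have hinv : (√τ)⁻¹ ≤ 1 := inv_le_one_of_one_le₀ hst
    have hle : (√τ)⁻¹ ≤ π := by linarith [pi_gt_three]
    have h0 : 0 ≤ (√τ)⁻¹ := by positivity
    have hcont : Continuous fun θ => symb θ * exp (-τ * symb θ) := by fun_prop
    calc 2 / 15 * exp (-1) / (τ * √τ)
        = ∫ θ in (0 : ℝ)..(√τ)⁻¹, 2 / 5 * exp (-1) * θ ^ 2 := by
          rw [intervalIntegral.integral_const_mul, integral_pow]
          rw [← hsq, sqrt_sq (by positivity), inv_pow]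
          field_simp
          norm_num
          ring
      _ ≤ ∫ θ in (0 : ℝ)..(√τ)⁻¹, symb θ * exp (-τ * symb θ) := by
          refine integral_mono_on h0 (Continuous.intervalIntegrable (by fun_prop) _ _)
            (hcont.intervalIntegrable _ _) fun θ hθ => ?_
          have h1 := two_fifths_sq_le_symb hθ.1 (hθ.2.trans hle)
          have h2 : τ * symb θ ≤ 1 := by
            have h3 : θ ^ 2 ≤ (√τ)⁻¹ ^ 2 := pow_le_pow_left₀ hθ.1 hθ.2 2
            rw [inv_pow, hsq] at h3
            calc τ * symb θ ≤ τ * τ⁻¹ := by gcongr; exact (symb_le_sq θ).trans h3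
              _ = 1 := mul_inv_cancel₀ hτ0.ne'
          have h3 : exp (-1) ≤ exp (-τ * symb θ) := exp_le_exp.2 (by linarith)
          calc 2 / 5 * exp (-1) * θ ^ 2 = (2 / 5 * θ ^ 2) * exp (-1) := by ring
            _ ≤ _ := mul_le_mul h1 h3 (exp_pos _).le (symb_nonneg θ)
      _ ≤ _ := by
          rw [← integral_add_adjacent_intervals (hcont.intervalIntegrable 0 (√τ)⁻¹)
            (hcont.intervalIntegrable (√τ)⁻¹ π)]
          exact le_add_of_nonneg_right (integral_nonneg hle fun θ _ =>
            mul_nonneg (symb_nonneg θ) (exp_pos _).le)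
  have hB : ∀ τ : ℝ, 0 < τ →
      ∫ θ in (0 : ℝ)..π, symb θ * exp (-τ * symb θ) * θ ^ 2 ≤ 100 / (τ ^ 2 * √τ) := by
    intro τ hτ
    refine (le_abs_self _).trans ((abs_integral_le_of_gaussian (K := 50 / τ ^ 2) hτ
      (by positivity) fun θ h0 h1 => ?_).trans_eq (by field_simp; norm_num))
    rw [abs_of_nonneg (mul_nonneg (mul_nonneg (symb_nonneg θ) (exp_pos _).le) (sq_nonneg θ))]
    have hc := exp_symb_le hτ.le h0 h1
    have hd := sq_mul_exp_le (y := τ * θ ^ 2) (by positivity)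
    rw [show -(τ * θ ^ 2) / 5 = -(τ / 5) * θ ^ 2 by ring] at hd
    set e := exp (-(τ / 5) * θ ^ 2)
    have he : 0 < e := exp_pos _
    calc _ ≤ θ ^ 2 * (e * e) * θ ^ 2 := by
          gcongr
          exact symb_le_sq θ
      _ = ((τ * θ ^ 2) ^ 2 * e) / τ ^ 2 * e := by field_simp
      _ ≤ 50 / τ ^ 2 * e := by gcongr
  refine ⟨π⁻¹ * (exp (-1) / 15), by positivity, 750 * exp 1,
    by nlinarith [add_one_le_exp (1 : ℝ)], fun x τ hτ hx => ?_⟩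
  have hτ0 : 0 < τ := by linarith
  have hst : 0 < √τ := sqrt_pos.2 hτ0
  rw [heatKernelLap_eq_integral, neg_le_neg_iff, mul_div_assoc]
  gcongr
  have h1 : ∫ θ in (0 : ℝ)..π, (symb θ * exp (-τ * symb θ)
        - x ^ 2 / 2 * (symb θ * exp (-τ * symb θ) * θ ^ 2))
      ≤ ∫ θ in (0 : ℝ)..π, symb θ * exp (-τ * symb θ) * cos (x * θ) := by
    refine integral_mono_on pi_pos.le (Continuous.intervalIntegrable (by fun_prop) _ _)
      (Continuous.intervalIntegrable (by fun_prop) _ _) fun θ _ => ?_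
    have h2 := one_sub_sq_div_two_le_cos (x := x * θ)
    have h3 := mul_le_mul_of_nonneg_left h2 (mul_nonneg (symb_nonneg θ) (exp_pos (-τ * symb θ)).le)
    linarith
  rw [intervalIntegral.integral_sub (Continuous.intervalIntegrable (by fun_prop) _ _)
    (Continuous.intervalIntegrable (by fun_prop) _ _), intervalIntegral.integral_const_mul] at h1
  refine le_trans ?_ h1
  have h4 := hA τ hτ
  have h5 := mul_le_mul_of_nonneg_left (hB τ hτ0) (by positivity : 0 ≤ x ^ 2 / 2)
  have h6 : x ^ 2 / 2 * (100 / (τ ^ 2 * √τ)) ≤ exp (-1) / 15 / (τ * √τ) := by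
    rw [div_div, div_mul_div_comm, div_le_div_iff₀ (by positivity) (by positivity), exp_neg]
    have := mul_le_mul_of_nonneg_right hx (by positivity : 0 ≤ τ * √τ)
    have he := exp_pos (1 : ℝ)
    field_simp
    field_simp at this
    nlinarith
  have h7 : 2 / 15 * exp (-1) / (τ * √τ)
      = exp (-1) / 15 / (τ * √τ) + exp (-1) / 15 / (τ * √τ) := by ring
  linarith

lemma hasDerivAt_symb (θ : ℝ) : HasDerivAt symb (2 * sin θ) θ := by
  have := ((hasDerivAt_cos θ).const_mul 2).const_sub 2
  exact this.congr_deriv (by ring)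

lemma sin_sq_le_symb (θ : ℝ) : sin θ ^ 2 ≤ symb θ := by
  have := sin_sq_add_cos_sq θ
  unfold symb; nlinarith [sq_nonneg (1 - cos θ)]

/-- Spatial decay of the time derivative of the heat kernel, from two integrations by parts in the
Fourier variable. -/
lemma abs_heatKernelLap_le {m : ℕ} (hm : 1 ≤ m) {τ : ℝ} (hτ : 0 < τ) :
    |heatKernelLap m τ| ≤ 64 / (m ^ 2 * √τ) := by
  have hc := continuous_symb
  have hm0 : (0 : ℝ) < m := by exact_mod_cast hm
  set F1 : ℝ → ℝ := fun θ => 2 * sin θ * (1 - τ * symb θ) * exp (-τ * symb θ)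
  set F2 : ℝ → ℝ := fun θ => (2 * cos θ * (1 - τ * symb θ)
    + 4 * sin θ ^ 2 * (τ ^ 2 * symb θ - 2 * τ)) * exp (-τ * symb θ)
  have hE : ∀ θ, HasDerivAt (fun θ => exp (-τ * symb θ))
      (exp (-τ * symb θ) * (-τ * (2 * sin θ))) θ := fun θ =>
    ((hasDerivAt_symb θ).const_mul (-τ)).exp
  have hF : ∀ θ, HasDerivAt (fun θ => symb θ * exp (-τ * symb θ)) (F1 θ) θ := fun θ =>
    ((hasDerivAt_symb θ).mul (hE θ)).congr_deriv (by simp only [F1]; ring)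
  have hF1 : ∀ θ, HasDerivAt F1 (F2 θ) θ := fun θ =>
    ((((hasDerivAt_sin θ).const_mul 2).mul
      (((hasDerivAt_symb θ).const_mul τ).const_sub 1)).mul (hE θ)).congr_deriv
      (by simp only [F2, Pi.mul_apply]; ring)
  have hv : ∀ θ : ℝ, HasDerivAt (fun θ => sin (m * θ) / m) (cos (m * θ)) θ := fun θ => by
    have := (((hasDerivAt_id θ).const_mul (m : ℝ)).sin).div_const (m : ℝ)
    refine this.congr_deriv ?_
    simp only [id, mul_one]
    field_simp
  have hw : ∀ θ : ℝ, HasDerivAt (fun θ => -cos (m * θ) / m ^ 2) (sin (m * θ) / m) θ := fun θ => by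
    have := (((hasDerivAt_id θ).const_mul (m : ℝ)).cos).neg.div_const ((m : ℝ) ^ 2)
    refine this.congr_deriv ?_
    simp only [id, mul_one]
    field_simp
  have cF1 : Continuous F1 := by fun_prop
  have cF2 : Continuous F2 := by fun_prop
  have i1 := integral_mul_deriv_eq_deriv_mul (a := 0) (b := π) (fun θ _ => hF θ) (fun θ _ => hv θ)
    (cF1.intervalIntegrable _ _) (Continuous.intervalIntegrable (by fun_prop) _ _)
  have i2 := integral_mul_deriv_eq_deriv_mul (a := 0) (b := π) (fun θ _ => hF1 θ) (fun θ _ => hw θ)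
    (cF2.intervalIntegrable _ _) (Continuous.intervalIntegrable (by fun_prop) _ _)
  have hs0 : symb 0 = 0 := by simp [symb]
  rw [i2] at i1
  have e1 : F1 π = 0 := by simp [F1]
  have e2 : F1 0 = 0 := by simp [F1]
  rw [sin_nat_mul_pi, hs0, e1, e2] at i1
  simp only [zero_div, mul_zero, zero_mul, sub_zero, zero_sub, neg_neg] at i1
  have i3 : ∫ θ in (0 : ℝ)..π, F2 θ * (-cos (m * θ) / m ^ 2)
      = -(1 / m ^ 2) * ∫ θ in (0 : ℝ)..π, F2 θ * cos (m * θ) := by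
    rw [← intervalIntegral.integral_const_mul]
    exact integral_congr fun θ _ => by ring
  have i4 : |∫ θ in (0 : ℝ)..π, F2 θ * cos (m * θ)| ≤ 2 * 32 / √τ := by
    refine abs_integral_le_of_gaussian hτ (by norm_num) fun θ h0 h1 => ?_
    have hy0 : 0 ≤ τ * symb θ := mul_nonneg hτ.le (symb_nonneg θ)
    have hb : |2 * cos θ * (1 - τ * symb θ) + 4 * sin θ ^ 2 * (τ ^ 2 * symb θ - 2 * τ)|
        ≤ 2 + 10 * (τ * symb θ) + 4 * (τ * symb θ) ^ 2 := by
      have a1 : |2 * cos θ * (1 - τ * symb θ)| ≤ 2 * 1 * (1 + τ * symb θ) := by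
        rw [abs_mul, abs_mul, abs_two]
        gcongr
        · exact abs_cos_le_one θ
        · rw [abs_le]; constructor <;> linarith
      have a2 : |4 * sin θ ^ 2 * (τ ^ 2 * symb θ - 2 * τ)|
          ≤ 4 * symb θ * (τ ^ 2 * symb θ + 2 * τ) := by
        have h2 : 0 ≤ τ ^ 2 * symb θ := mul_nonneg (sq_nonneg τ) (symb_nonneg θ)
        rw [abs_mul, abs_of_nonneg (by positivity : 0 ≤ 4 * sin θ ^ 2)]
        refine mul_le_mul (by linarith [sin_sq_le_symb θ]) ?_ (abs_nonneg _)
          (by linarith [symb_nonneg θ])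
        rw [abs_le]; constructor <;> linarith
      calc _ ≤ _ := abs_add_le _ _
        _ ≤ _ := add_le_add a1 a2
        _ = _ := by ring
    have hq := quadratic_le_exp_of_nonneg (x := τ * symb θ / 2) (by positivity)
    have hE2 : exp (-τ * symb θ) = exp (-(τ * symb θ / 2)) * exp (-(τ * symb θ / 2)) := by
      rw [← exp_add]; ring_nf
    have h3 : exp (-(τ * symb θ / 2)) ≤ exp (-(τ / 5) * θ ^ 2) := exp_le_exp.2 (by
      nlinarith [mul_le_mul_of_nonneg_left (two_fifths_sq_le_symb h0 h1) hτ.le])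
    rw [abs_mul]
    simp only [F2]
    rw [abs_mul, abs_of_pos (exp_pos _)]
    calc _ ≤ (2 + 10 * (τ * symb θ) + 4 * (τ * symb θ) ^ 2) * exp (-τ * symb θ) * 1 := by
          gcongr
          exact abs_cos_le_one _
      _ ≤ (32 * exp (τ * symb θ / 2)) * exp (-τ * symb θ) * 1 := by gcongr; nlinarith
      _ = 32 * (exp (τ * symb θ / 2) * exp (-(τ * symb θ / 2))) * exp (-(τ * symb θ / 2)) := by
          rw [hE2]; ring
      _ = 32 * exp (-(τ * symb θ / 2)) := by rw [← exp_add, add_neg_cancel, exp_zero, mul_one]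
      _ ≤ _ := by gcongr
  have hpi : π⁻¹ ≤ 1 := inv_le_one_of_one_le₀ (by linarith [pi_gt_three])
  rw [heatKernelLap_eq_integral, i1, i3, abs_neg, abs_mul, abs_mul, abs_neg,
    abs_of_pos (by positivity), abs_of_pos (by positivity : (0 : ℝ) < 1 / m ^ 2)]
  calc _ ≤ 1 * (1 / (m : ℝ) ^ 2 * (2 * 32 / √τ)) := by gcongr
    _ = _ := by field_simp; norm_num

/-! ### Partial masses of the heat kernel -/

/-- Half of the error function. -/
def halfErf (z : ℝ) : ℝ := (√π)⁻¹ * ∫ s in (0 : ℝ)..z, exp (-s ^ 2)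

lemma hasDerivAt_halfErf (z : ℝ) : HasDerivAt halfErf ((√π)⁻¹ * exp (-z ^ 2)) z := by
  have hc : Continuous fun s : ℝ => exp (-s ^ 2) := by fun_prop
  exact (integral_hasDerivAt_right (hc.intervalIntegrable _ _)
    (hc.stronglyMeasurableAtFilter _ _) hc.continuousAt).const_mul _

@[simp] lemma halfErf_zero : halfErf 0 = 0 := by simp [halfErf]

lemma monotone_halfErf : Monotone halfErf :=
  monotone_of_deriv_nonneg (fun z => (hasDerivAt_halfErf z).differentiableAt) fun z => by
    rw [(hasDerivAt_halfErf z).deriv]; positivity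

lemma halfErf_nonneg {z : ℝ} (hz : 0 ≤ z) : 0 ≤ halfErf z := by
  simpa using monotone_halfErf hz

lemma halfErf_le_half {z : ℝ} (hz : 0 ≤ z) : halfErf z ≤ 1 / 2 := by
  have h1 := integral_gaussian_Ioi 1
  have hi : Integrable fun s : ℝ => exp (-1 * s ^ 2) := integrable_exp_neg_mul_sq one_pos
  have h2 : ∫ s in (0 : ℝ)..z, exp (-s ^ 2) ≤ √π / 2 := by
    rw [integral_of_le hz]
    simp only [neg_mul, one_mul, div_one] at h1 hi
    rw [← h1]
    exact setIntegral_mono_set hi.integrableOn (ae_of_all _ fun θ => by positivity)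
      (LE.le.eventuallyLE fun θ hθ => hθ.1)
  have h3 : 0 < √π := sqrt_pos.2 pi_pos
  calc halfErf z ≤ (√π)⁻¹ * (√π / 2) := by unfold halfErf; gcongr
    _ = 1 / 2 := by field_simp

lemma hasDerivAt_gaussKernel (x : ℝ) {τ : ℝ} (hτ : 0 < τ) :
    HasDerivAt (fun x => gaussKernel x τ) (-(x / (2 * τ)) * gaussKernel x τ) x := by
  have h : HasDerivAt (fun x : ℝ => -x ^ 2 / (4 * τ)) (-(x / (2 * τ))) x := by
    refine ((((hasDerivAt_id x).fun_pow 2).fun_neg).div_const (4 * τ)).congr_deriv ?_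
    simp only [id]
    field_simp
    norm_num
    ring
  refine (h.exp.div_const _).congr_deriv ?_
  unfold gaussKernel
  ring

lemma gaussKernel_nonneg (x τ : ℝ) : 0 ≤ gaussKernel x τ := by
  unfold gaussKernel; positivity

lemma integral_gaussKernel (m : ℝ) {τ : ℝ} (hτ : 0 < τ) :
    ∫ x in (0 : ℝ)..m, gaussKernel x τ = halfErf (m / (2 * √τ)) := by
  have hst : 0 < √τ := sqrt_pos.2 hτ
  have hd : ∀ x, HasDerivAt (fun x => halfErf (x / (2 * √τ))) (gaussKernel x τ) x := fun x => by
    have := (hasDerivAt_halfErf (x / (2 * √τ))).comp x ((hasDerivAt_id x).div_const (2 * √τ))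
    refine this.congr_deriv ?_
    unfold gaussKernel
    rw [sqrt_mul (by positivity), sqrt_mul (by positivity),
      show √(4 : ℝ) = 2 by rw [show (4 : ℝ) = 2 ^ 2 by norm_num]; exact sqrt_sq (by norm_num)]
    rw [show -(x / (2 * √τ)) ^ 2 = -x ^ 2 / (4 * τ) by rw [div_pow, mul_pow, sq_sqrt hτ.le]; ring]
    have := sqrt_pos.2 pi_pos
    field_simp
  have hcont : Continuous fun x => gaussKernel x τ :=
    continuous_iff_continuousAt.2 fun x => (hasDerivAt_gaussKernel x hτ).continuousAt
  rw [integral_eq_sub_of_hasDerivAt (fun x _ => hd x) (hcont.intervalIntegrable _ _)]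
  simp

/-- The trapezoidal rule on one interval of unit length. -/
lemma integral_sub_average_le {f f' f'' : ℝ → ℝ} {M : ℝ} (hf : ∀ x, HasDerivAt f (f' x) x)
    (hf' : ∀ x, HasDerivAt f' (f'' x) x) (hM : ∀ x, |f'' x| ≤ M) (i : ℝ) :
    ∫ x in i..i + 1, f x ≤ (f i + f (i + 1)) / 2 + M := by
  have hM0 : 0 ≤ M := (abs_nonneg _).trans (hM 0)
  have hcont : Continuous f := continuous_iff_continuousAt.2 fun x => (hf x).continuousAt
  have hlip : ∀ ξ ∈ Icc i (i + 1), ∀ η ∈ Icc i (i + 1), f' ξ - f' η ≤ M := fun ξ hξ η hη => by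
    have := (convex_univ (𝕜 := ℝ)).norm_image_sub_le_of_norm_hasDerivWithin_le
      (fun x _ => (hf' x).hasDerivWithinAt) (fun x _ => hM x) (mem_univ η) (mem_univ ξ)
    rw [Real.norm_eq_abs, Real.norm_eq_abs] at this
    have h1 : |ξ - η| ≤ 1 := abs_le.2 ⟨by linarith [hξ.1, hη.2], by linarith [hξ.2, hη.1]⟩
    calc _ ≤ _ := le_abs_self _
      _ ≤ M * |ξ - η| := this
      _ ≤ M := mul_le_of_le_one_right hM0 h1
  obtain ⟨η, hη, hηe⟩ := exists_hasDerivAt_eq_slope f f' (by linarith : i < i + 1)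
    hcont.continuousOn (fun x _ => hf x)
  rw [add_sub_cancel_left, div_one] at hηe
  have hpt : ∀ x ∈ Icc i (i + 1), f x ≤ f i + (f (i + 1) - f i) * (x - i) + M := fun x hx => by
    rcases hx.1.eq_or_lt with h | h
    · rw [← h]; linarith
    obtain ⟨ξ, hξ, hξe⟩ := exists_hasDerivAt_eq_slope f f' h hcont.continuousOn (fun x _ => hf x)
    rw [eq_div_iff (by linarith)] at hξe
    have := hlip ξ ⟨hξ.1.le, hξ.2.le.trans hx.2⟩ η ⟨hη.1.le, hη.2.le⟩
    rw [hηe] at this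
    nlinarith [hx.2]
  have := integral_mono_on (μ := volume) (by linarith) (hcont.intervalIntegrable i (i + 1))
    (Continuous.intervalIntegrable (by fun_prop) _ _) hpt
  refine this.trans_eq ?_
  rw [intervalIntegral.integral_add (Continuous.intervalIntegrable (by fun_prop) _ _)
    (Continuous.intervalIntegrable (by fun_prop) _ _),
    intervalIntegral.integral_add (Continuous.intervalIntegrable (by fun_prop) _ _)
    (Continuous.intervalIntegrable (by fun_prop) _ _), intervalIntegral.integral_const_mul,
    intervalIntegral.integral_sub (Continuous.intervalIntegrable (by fun_prop) _ _)
    (Continuous.intervalIntegrable (by fun_prop) _ _)]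
  simp
  ring

lemma integral_gaussKernel_le (i : ℝ) {τ : ℝ} (hτ : 0 < τ) :
    ∫ x in i..i + 1, gaussKernel x τ
      ≤ (gaussKernel i τ + gaussKernel (i + 1) τ) / 2 + 1 / (τ * √τ) := by
  have hst : 0 < √τ := sqrt_pos.2 hτ
  refine integral_sub_average_le (fun x => hasDerivAt_gaussKernel x hτ)
    (f'' := fun x => (x ^ 2 / (4 * τ) - 1 / 2) / τ * gaussKernel x τ) (fun x => ?_) (fun x => ?_) i
  · have := (((hasDerivAt_id x).div_const (2 * τ)).fun_neg).mul (hasDerivAt_gaussKernel x hτ)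
    refine this.congr_deriv ?_
    simp only [id]
    field_simp
    ring
  · have hy : 0 ≤ x ^ 2 / (4 * τ) := by positivity
    have h1 := add_one_le_exp (x ^ 2 / (4 * τ))
    have h2 : |x ^ 2 / (4 * τ) - 1 / 2| ≤ exp (x ^ 2 / (4 * τ)) := by
      rw [abs_le]; constructor <;> linarith
    have h3 : √τ ≤ √(4 * π * τ) := sqrt_le_sqrt (by nlinarith [pi_gt_three])
    rw [abs_mul, abs_div, abs_of_pos hτ, abs_of_nonneg (gaussKernel_nonneg x τ), gaussKernel]
    calc _ ≤ exp (x ^ 2 / (4 * τ)) / τ * (exp (-x ^ 2 / (4 * τ)) / √τ) := by gcongr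
      _ = (exp (x ^ 2 / (4 * τ)) * exp (-x ^ 2 / (4 * τ))) / (τ * √τ) := by field_simp
      _ = _ := by rw [← exp_add, neg_div, add_neg_cancel, exp_zero]

/-- A lower bound for the symmetric difference of the source solution in space by the derivative of
its continuum analogue. The difference is a trapezoidal sum of the heat kernel. -/
lemma halfErf_le_heatSource_sub {m : ℕ} (hm : 1 ≤ m) {τ : ℝ} (hτ : 0 < τ) :
    halfErf (m / (2 * √τ)) - 1 / 2 - 101 * m / (τ * √τ)
      ≤ (heatSource (m + 1) τ - heatSource (m - 1) τ) / 2 := by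
  have hcont : Continuous fun x => gaussKernel x τ :=
    continuous_iff_continuousAt.2 fun x => (hasDerivAt_gaussKernel x hτ).continuousAt
  have hY : (heatSource (m + 1) τ - heatSource (m - 1) τ) / 2
      = -1 / 2 + ∑ i ∈ Finset.range m, (heatKernel i τ + heatKernel (i + 1) τ) / 2 := by
    obtain ⟨m, rfl⟩ := Nat.exists_eq_add_of_le' hm
    have h1 := heatSource_succ_sub (m + 1) τ
    have h2 := heatSource_succ_sub m τ
    have h3 : ∑ i ∈ Finset.range (m + 1), heatKernel i τ
        = heatKernel 0 τ + ∑ i ∈ Finset.range m, heatKernel (i + 1) τ := by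
      rw [Finset.sum_range_succ', add_comm]; simp
    have h4 : ∑ i ∈ Finset.range (m + 1), heatKernel (i + 1) τ
        = ∑ i ∈ Finset.range m, heatKernel (i + 1) τ + heatKernel (m + 1) τ :=
      Finset.sum_range_succ _ _
    rw [← Finset.sum_div, Finset.sum_add_distrib, h3]
    rw [Nat.cast_succ, add_sub_cancel_right]
    rw [Nat.cast_succ] at h1
    linarith
  have hsum : halfErf (m / (2 * √τ))
      = ∑ i ∈ Finset.range m, ∫ x in (i : ℝ)..i + 1, gaussKernel x τ := by
    have := sum_integral_adjacent_intervals (f := fun x => gaussKernel x τ) (μ := volume)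
      (a := fun i : ℕ => (i : ℝ)) (n := m) fun k _ => hcont.intervalIntegrable _ _
    rw [← integral_gaussKernel m hτ]
    simp only [Nat.cast_succ, Nat.cast_zero] at this
    exact this.symm
  have hterm : ∀ i ∈ Finset.range m, ∫ x in (i : ℝ)..i + 1, gaussKernel x τ
      ≤ (heatKernel i τ + heatKernel (i + 1) τ) / 2 + 101 / (τ * √τ) := fun i _ => by
    have h1 := integral_gaussKernel_le i hτ
    have h2 := (abs_le.1 (abs_heatKernel_sub_gaussKernel_le i hτ)).1
    have h3 := (abs_le.1 (abs_heatKernel_sub_gaussKernel_le (i + 1) hτ)).1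
    have h4 : 101 / (τ * √τ) = 100 / (τ * √τ) + 1 / (τ * √τ) := by ring
    linarith
  have h := Finset.sum_le_sum hterm
  rw [← hsum, Finset.sum_add_distrib, Finset.sum_const, Finset.card_range, nsmul_eq_mul] at h
  rw [hY, show 101 * (m : ℝ) / (τ * √τ) = m * (101 / (τ * √τ)) by ring]
  linarith

lemma abs_heatSource_sub_sub_le (m : ℝ) {r s σ : ℝ} (hσ : 0 < σ) (hr : σ ≤ r) (hs : σ ≤ s) :
    |(heatSource (m + 1) r - heatSource (m - 1) r) / 2
      - (heatSource (m + 1) s - heatSource (m - 1) s) / 2| ≤ 4 / σ * |r - s| := by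
  have := (convex_Ici σ).norm_image_sub_le_of_norm_hasDerivWithin_le (C := 4 / σ)
    (f := fun τ => (heatSource (m + 1) τ - heatSource (m - 1) τ) / 2)
    (f' := fun τ => (heatKernel (m + 1) τ - heatKernel (m - 1) τ) / 2)
    (fun x _ => (((hasDerivAt_heatSource _ x).sub
      (hasDerivAt_heatSource _ x)).div_const 2).hasDerivWithinAt) (fun x (hx : σ ≤ x) => ?_) hs hr
  · simpa only [Real.norm_eq_abs] using this
  · have h1 := abs_heatKernel_sub_le m (hσ.trans_le hx)
    rw [Real.norm_eq_abs, abs_div, abs_two, div_le_iff₀ two_pos]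
    refine h1.trans ?_
    rw [div_mul_eq_mul_div]
    norm_num
    gcongr

section

/-! ### The linear problem on the lattice -/

/-- A mean value inequality for functions that are differentiable off a finite set. -/
lemma abs_sub_le_of_abs_deriv_le {f f' B B' : ℝ → ℝ} {S : Finset ℝ} {a b : ℝ} (hab : a ≤ b)
    (hf : ContinuousOn f (Icc a b)) (hf' : ∀ t ∈ Ioo a b, t ∉ S → HasDerivAt f (f' t) t)
    (hB : ∀ t, HasDerivAt B (B' t) t) (hB' : Continuous B')
    (h : ∀ t ∈ Ioo a b, t ∉ S → |f' t| ≤ B' t) : |f b - f a| ≤ B b - B a := by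
  have hS : (S : Set ℝ).Countable := S.countable_toSet
  have hae : ∀ᵐ t ∂volume.restrict (Ioc a b), ‖deriv f t‖ ≤ B' t := by
    have h1 : ∀ᵐ t : ℝ, t ∉ (S : Set ℝ) := hS.ae_notMem _
    have h2 : ∀ᵐ t : ℝ, t ≠ b := by
      simpa using (countable_singleton b).ae_notMem volume
    rw [ae_restrict_iff' measurableSet_Ioc]
    filter_upwards [h1, h2] with t h1 h2 ht
    have ht' : t ∈ Ioo a b := ⟨ht.1, lt_of_le_of_ne ht.2 h2⟩
    rw [(hf' t ht' h1).deriv]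
    exact h t ht' h1
  have hint : IntervalIntegrable (deriv f) volume a b := by
    rw [intervalIntegrable_iff_integrableOn_Ioc_of_le hab]
    exact (hB'.integrableOn_Ioc).mono' (measurable_deriv f).aestronglyMeasurable hae
  rw [← integral_eq_sub_of_hasDerivAt (fun t _ => hB t) (hB'.intervalIntegrable _ _),
    ← integral_eq_of_hasDerivAt_off_countable_of_le f (deriv f) hab hS hf
      (fun t ht => (hf' t ht.1 ht.2).differentiableAt.hasDerivAt) hint]
  exact norm_integral_le_of_norm_le hab ((ae_restrict_iff' measurableSet_Ioc).1 hae)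
    (hB'.intervalIntegrable _ _)

namespace SolvesLattice

variable {F F' : ℤ → ℝ → ℝ} {S S' : Finset ℝ} {t₀ t₁ : ℝ} {w w' : ℤ → ℝ → ℝ}

lemma exists_growth (h : SolvesLattice F S t₀ t₁ w) :
    ∃ A ≥ 0, ∃ α ≥ 0, ∀ j, ∀ t ∈ Icc t₀ t₁, |w j t| ≤ A * exp (α * |(j : ℝ)|) := by
  obtain ⟨A, α, hA⟩ := h.growth
  refine ⟨|A|, abs_nonneg _, |α|, abs_nonneg _, fun j t ht => (hA j t ht).trans ?_⟩
  gcongr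
  · exact le_abs_self _
  · exact le_abs_self _

lemma mono {s₀ s₁ : ℝ} (h : SolvesLattice F S t₀ t₁ w) (h0 : t₀ ≤ s₀) (h1 : s₁ ≤ t₁) :
    SolvesLattice F S s₀ s₁ w where
  continuousOn j := (h.continuousOn j).mono (Icc_subset_Icc h0 h1)
  growth := by
    obtain ⟨A, α, hA⟩ := h.growth
    exact ⟨A, α, fun j t ht => hA j t (Icc_subset_Icc h0 h1 ht)⟩
  hasDerivAt t ht := h.hasDerivAt t (Ioo_subset_Ioo h0 h1 ht)

lemma congr (h : SolvesLattice F S t₀ t₁ w) (hF : ∀ t ∈ Ioo t₀ t₁, ∀ j, F j t = F' j t) :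
    SolvesLattice F' S t₀ t₁ w where
  continuousOn := h.continuousOn
  growth := h.growth
  hasDerivAt t ht hS j := by
    rw [← hF t ht j]
    exact h.hasDerivAt t ht hS j

lemma sub (h : SolvesLattice F S t₀ t₁ w) (h' : SolvesLattice F' S' t₀ t₁ w') :
    SolvesLattice (fun j t => F j t - F' j t) (S ∪ S') t₀ t₁ (fun j t => w j t - w' j t) where
  continuousOn j := (h.continuousOn j).sub (h'.continuousOn j)
  growth := by
    obtain ⟨A, hA0, α, hα, hA⟩ := h.exists_growth
    obtain ⟨B, hB0, β, hβ, hB⟩ := h'.exists_growth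
    refine ⟨A + B, α + β, fun j t ht => (abs_sub _ _).trans ?_⟩
    rw [add_mul]
    refine add_le_add ((hA j t ht).trans ?_) ((hB j t ht).trans ?_)
    · gcongr; linarith
    · gcongr; linarith
  hasDerivAt t ht hS j := by
    rw [Finset.mem_union, not_or] at hS
    refine ((h.hasDerivAt t ht hS.1 j).sub (h'.hasDerivAt t ht hS.2 j)).congr_deriv ?_
    simp only [latticeLaplacian]
    ring

/-- Solutions with bounded sources and vanishing initial values are bounded, uniformly on the
lattice. The growth condition is used to start a Picard iteration. -/
lemma abs_le (h : SolvesLattice F S t₀ t₁ w) (h0 : ∀ j, w j t₀ = 0) {B : ℝ} (hB : 0 ≤ B)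
    (hF : ∀ t ∈ Ioo t₀ t₁, ∀ j, |F j t| ≤ B) {t : ℝ} (ht : t ∈ Icc t₀ t₁) (j : ℤ) :
    |w j t| ≤ B / 4 * (exp (4 * (t - t₀)) - 1) := by
  obtain ⟨A, hA0, α, hα, hA⟩ := h.exists_growth
  set L := 2 * exp α + 2
  have hstep : ∀ j : ℤ, exp (α * |((j + 1 : ℤ) : ℝ)|) + 2 * exp (α * |(j : ℝ)|)
      + exp (α * |((j - 1 : ℤ) : ℝ)|) ≤ L * exp (α * |(j : ℝ)|) := fun j => by
    have e1 : exp (α * |((j + 1 : ℤ) : ℝ)|) ≤ exp α * exp (α * |(j : ℝ)|) := by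
      rw [← exp_add]
      refine exp_le_exp.2 ?_
      have := abs_add_le (j : ℝ) 1
      push_cast
      rw [abs_one] at this
      nlinarith
    have e2 : exp (α * |((j - 1 : ℤ) : ℝ)|) ≤ exp α * exp (α * |(j : ℝ)|) := by
      rw [← exp_add]
      refine exp_le_exp.2 ?_
      have := abs_sub (j : ℝ) 1
      push_cast
      rw [abs_one] at this
      nlinarith
    simp only [L]
    linarith
  have main : ∀ k : ℕ, ∀ j, ∀ t ∈ Icc t₀ t₁, |w j t| ≤
      A * exp (α * |(j : ℝ)|) * ((L * (t - t₀)) ^ k / k.factorial)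
        + B / 4 * (exp (4 * (t - t₀)) - 1) := by
    intro k
    induction k with
    | zero =>
      intro j t ht
      have h1 : 1 ≤ exp (4 * (t - t₀)) := one_le_exp (by linarith [ht.1])
      have h2 : 0 ≤ B / 4 * (exp (4 * (t - t₀)) - 1) := mul_nonneg (by positivity) (by linarith)
      simpa using (hA j t ht).trans (le_add_of_nonneg_right h2)
    | succ k ih =>
      intro j t ht
      have hd : ∀ r, HasDerivAt (fun r => A * exp (α * |(j : ℝ)|)
            * ((L * (r - t₀)) ^ (k + 1) / (k + 1).factorial) + B / 4 * (exp (4 * (r - t₀)) - 1))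
          (A * (L * exp (α * |(j : ℝ)|)) * ((L * (r - t₀)) ^ k / k.factorial)
            + B * exp (4 * (r - t₀))) r := by
        intro r
        have h1 : HasDerivAt (fun r : ℝ => (L * (r - t₀)) ^ (k + 1))
            (((k + 1 : ℕ) : ℝ) * (L * (r - t₀)) ^ k * L) r := by
          simpa using (((hasDerivAt_id r).sub_const t₀).const_mul L).fun_pow (k + 1)
        have h2 : HasDerivAt (fun r : ℝ => exp (4 * (r - t₀))) (exp (4 * (r - t₀)) * 4) r := by
          simpa using (((hasDerivAt_id r).sub_const t₀).const_mul (4 : ℝ)).exp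
        refine (((h1.div_const _).const_mul _).add ((h2.sub_const 1).const_mul _)).congr_deriv ?_
        rw [Nat.factorial_succ]
        push_cast
        have := k.factorial_ne_zero
        field_simp
      have := abs_sub_le_of_abs_deriv_le ht.1 ((h.continuousOn j).mono (Icc_subset_Icc_right ht.2))
        (fun r hr hS => h.hasDerivAt r ⟨hr.1, hr.2.trans_le ht.2⟩ hS j) hd (by fun_prop)
        fun r hr hS => ?_
      · rw [h0, sub_zero] at this
        simpa using this
      · have hr' : r ∈ Icc t₀ t₁ := ⟨hr.1.le, hr.2.le.trans ht.2⟩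
        have e0 := ih j r hr'
        have e1 := ih (j + 1) r hr'
        have e2 := ih (j - 1) r hr'
        have e3 := hF r ⟨hr.1, hr.2.trans_le ht.2⟩ j
        have e4 : 0 ≤ A * ((L * (r - t₀)) ^ k / k.factorial) := by
          have : 0 ≤ r - t₀ := by linarith [hr.1]
          positivity
        have e5 := mul_le_mul_of_nonneg_left (hstep j) e4
        calc |latticeLaplacian w j r + F j r|
            ≤ |w (j + 1) r| + 2 * |w j r| + |w (j - 1) r| + |F j r| := by
              refine (abs_add_le _ _).trans (add_le_add_left ?_ _)
              unfold latticeLaplacian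
              refine (abs_add_le _ _).trans (add_le_add_left ((abs_sub _ _).trans ?_) _)
              rw [abs_mul, abs_two]
          _ ≤ _ := by
              generalize (L * (r - t₀)) ^ k / (k.factorial : ℝ) = q at *
              nlinarith
  have hlim : Tendsto (fun k : ℕ => A * exp (α * |(j : ℝ)|) * ((L * (t - t₀)) ^ k / k.factorial)
      + B / 4 * (exp (4 * (t - t₀)) - 1)) atTop (𝓝 (B / 4 * (exp (4 * (t - t₀)) - 1))) := by
    simpa using ((FloorSemiring.tendsto_pow_div_factorial_atTop (L * (t - t₀))).const_mul
      (A * exp (α * |(j : ℝ)|))).add_const (B / 4 * (exp (4 * (t - t₀)) - 1))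
  exact ge_of_tendsto' hlim fun k => main k j t ht

lemma unique (h : SolvesLattice F S t₀ t₁ w) (h' : SolvesLattice F S' t₀ t₁ w')
    (h0 : ∀ j, w j t₀ = w' j t₀) {t : ℝ} (ht : t ∈ Icc t₀ t₁) (j : ℤ) : w j t = w' j t := by
  have := (h.sub h').abs_le (B := 0) (fun j => by simp [h0]) le_rfl (fun t _ j => by simp) ht j
  simpa [sub_eq_zero] using this

end SolvesLattice

/-- The solution of the linear problem with initial values `-c j²` and source `h₁`, where the source
at the nodes `±k`, `k < n`, is switched off at time `t k`. -/
def switchedSolution (c h₁ : ℝ) (n : ℕ) (t : ℕ → ℝ) (j : ℤ) (s : ℝ) : ℝ :=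
  -c * (j : ℝ) ^ 2 + (h₁ - 2 * c) * s
    - h₁ * ∑ k ∈ Finset.Ioo (-n : ℤ) n, heatSource (j - k) (max (s - t k.natAbs) 0)

variable {c h₁ : ℝ} {n : ℕ} {t : ℕ → ℝ}

lemma switchedSolution_initial (ht : ∀ k < n, 0 ≤ t k) (j : ℤ) :
    switchedSolution c h₁ n t j 0 = -c * (j : ℝ) ^ 2 := by
  have : ∀ k ∈ Finset.Ioo (-n : ℤ) n, heatSource (j - k) (max (0 - t k.natAbs) 0) = 0 := by
    intro k hk
    rw [Finset.mem_Ioo] at hk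
    rw [max_eq_right (by linarith [ht k.natAbs (by omega)]), heatSource_zero]
  rw [switchedSolution, Finset.sum_eq_zero this]
  ring

lemma hasDerivAt_heatSource_max (x : ℝ) {r s : ℝ} (h : s ≠ r) :
    HasDerivAt (fun s => heatSource x (max (s - r) 0))
      (if r ≤ s then heatKernel x (s - r) else 0) s := by
  rcases lt_or_gt_of_ne h with h | h
  · rw [if_neg (not_le.2 h)]
    refine (hasDerivAt_const s (0 : ℝ)).congr_of_eventuallyEq ?_
    filter_upwards [Iio_mem_nhds h] with q hq
    rw [max_eq_right (by linarith [show q < r from hq]), heatSource_zero]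
  · rw [if_pos h.le]
    have := (hasDerivAt_heatSource x (s - r)).comp s ((hasDerivAt_id s).sub_const r)
    rw [mul_one] at this
    refine this.congr_of_eventuallyEq ?_
    filter_upwards [Ioi_mem_nhds h] with q hq
    rw [max_eq_left (by linarith [show r < q from hq])]
    rfl

lemma continuous_heatSource (x : ℝ) : Continuous (heatSource x) :=
  continuous_iff_continuousAt.2 fun τ => (hasDerivAt_heatSource x τ).continuousAt

lemma switchedSolution_solves (hc : 0 ≤ c) (hh : 0 ≤ h₁) (ht : ∀ k < n, 0 ≤ t k) {t₀ t₁ : ℝ}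
    (h0 : 0 ≤ t₀) :
    SolvesLattice (prescribedConfig h₁ n t) ((Finset.range n).image t) t₀ t₁
      (switchedSolution c h₁ n t) where
  continuousOn j := by
    have := fun x => continuous_heatSource x
    unfold switchedSolution
    exact Continuous.continuousOn (by fun_prop)
  growth := by
    refine ⟨c + |h₁ - 2 * c| * |t₁| + h₁ * ((Finset.Ioo (-n : ℤ) n).card * |t₁|), 2,
      fun j s hs => ?_⟩
    have hs0 : 0 ≤ s := h0.trans hs.1
    have hs1 : s ≤ |t₁| := hs.2.trans (le_abs_self _)
    have e1 : (j : ℝ) ^ 2 ≤ exp (2 * |(j : ℝ)|) := by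
      have := quadratic_le_exp_of_nonneg (x := 2 * |(j : ℝ)|) (by positivity)
      rw [mul_pow, sq_abs] at this
      nlinarith [sq_nonneg (j : ℝ), abs_nonneg (j : ℝ)]
    have e2 : 1 ≤ exp (2 * |(j : ℝ)|) := one_le_exp (by positivity)
    have e3 : |∑ k ∈ Finset.Ioo (-n : ℤ) n, heatSource (j - k) (max (s - t k.natAbs) 0)|
        ≤ (Finset.Ioo (-n : ℤ) n).card * |t₁| := by
      rw [← nsmul_eq_mul]
      refine (Finset.abs_sum_le_sum_abs _ _).trans (Finset.sum_le_card_nsmul _ _ _ fun k hk => ?_)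
      rw [Finset.mem_Ioo] at hk
      refine (abs_heatSource_le _ (le_max_right _ _)).trans (max_le ?_ (abs_nonneg _))
      linarith [ht k.natAbs (by omega)]
    unfold switchedSolution
    calc _ ≤ c * (j : ℝ) ^ 2 + |h₁ - 2 * c| * s
          + h₁ * |∑ k ∈ Finset.Ioo (-n : ℤ) n, heatSource (j - k) (max (s - t k.natAbs) 0)| := by
          refine (abs_sub _ _).trans (add_le_add ((abs_add_le _ _).trans (add_le_add ?_ ?_)) ?_)
          · rw [neg_mul, abs_neg, abs_of_nonneg (by positivity)]
          · rw [abs_mul, abs_of_nonneg hs0]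
          · rw [abs_mul, abs_of_nonneg hh]
      _ ≤ c * exp (2 * |(j : ℝ)|) + |h₁ - 2 * c| * |t₁| * exp (2 * |(j : ℝ)|)
          + h₁ * ((Finset.Ioo (-n : ℤ) n).card * |t₁|) * exp (2 * |(j : ℝ)|) := by
          refine add_le_add (add_le_add (by gcongr) ?_) ?_
          · exact (mul_le_mul_of_nonneg_left hs1 (abs_nonneg _)).trans
              (le_mul_of_one_le_right (by positivity) e2)
          · exact (mul_le_mul_of_nonneg_left e3 hh).trans
              (le_mul_of_one_le_right (by positivity) e2)
      _ = _ := by ring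
  hasDerivAt s hs hS j := by
    have hne : ∀ k ∈ Finset.Ioo (-n : ℤ) n, s ≠ t k.natAbs := fun k hk h => by
      rw [Finset.mem_Ioo] at hk
      exact hS (Finset.mem_image.2 ⟨k.natAbs, Finset.mem_range.2 (by omega), h.symm⟩)
    have hsum := HasDerivAt.fun_sum fun (k : ℤ) hk => hasDerivAt_heatSource_max ((j : ℝ) - k) (hne k hk)
    have hd := ((((hasDerivAt_id s).const_mul (h₁ - 2 * c)).const_add (-c * (j : ℝ) ^ 2)).sub
      (hsum.const_mul h₁))
    refine hd.congr_deriv ?_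
    have hlap : ∀ k ∈ Finset.Ioo (-n : ℤ) n,
        heatSource (((j + 1 : ℤ) : ℝ) - k) (max (s - t k.natAbs) 0)
          - 2 * heatSource ((j : ℝ) - k) (max (s - t k.natAbs) 0)
          + heatSource (((j - 1 : ℤ) : ℝ) - k) (max (s - t k.natAbs) 0)
        = (if t k.natAbs ≤ s then heatKernel (j - k) (s - t k.natAbs) else 0)
          - if j = k then (if t k.natAbs ≤ s then 1 else 0) else 0 := by
      intro k _
      by_cases h : t k.natAbs ≤ s
      · have := heatSource_laplacian (j - k) (s - t k.natAbs)
        rw [max_eq_left (by linarith), if_pos h, if_pos h]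
        simp only [sub_eq_zero, Int.cast_sub] at this
        rw [← this, Int.cast_add, Int.cast_sub, Int.cast_one, add_sub_right_comm,
          sub_right_comm (j : ℝ) 1]
      · simp [max_eq_right (by linarith : s - t k.natAbs ≤ 0), h]
    have hδ : ∑ k ∈ Finset.Ioo (-n : ℤ) n, (if j = k then (if t k.natAbs ≤ s then (1 : ℝ) else 0)
        else 0) = if j.natAbs < n ∧ t j.natAbs ≤ s then 1 else 0 := by
      rw [Finset.sum_ite_eq]
      have : j ∈ Finset.Ioo (-n : ℤ) n ↔ j.natAbs < n := by rw [Finset.mem_Ioo]; omega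
      simp only [this]
      split_ifs <;> simp_all
    have hS1 := Finset.sum_congr rfl hlap
    rw [Finset.sum_add_distrib, Finset.sum_sub_distrib, Finset.sum_sub_distrib, hδ,
      ← Finset.mul_sum] at hS1
    have hp : prescribedConfig h₁ n t j s
        = h₁ - h₁ * if j.natAbs < n ∧ t j.natAbs ≤ s then 1 else 0 := by
      unfold prescribedConfig
      split_ifs <;> simp
    rw [hp]
    simp only [latticeLaplacian, switchedSolution]
    have hj1 : (((j + 1 : ℤ) : ℝ)) ^ 2 = (j : ℝ) ^ 2 + 2 * j + 1 := by push_cast; ring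
    have hj2 : (((j - 1 : ℤ) : ℝ)) ^ 2 = (j : ℝ) ^ 2 - 2 * j + 1 := by push_cast; ring
    rw [hj1, hj2]
    linear_combination h₁ * hS1

lemma prescribedConfig_eq_frozenConfig {j : ℤ} {s : ℝ} (h : ∀ k < n, t k ≤ s) :
    prescribedConfig h₁ n t j s = frozenConfig h₁ n j := by
  unfold prescribedConfig frozenConfig
  by_cases hj : j.natAbs < n
  · simp [hj, h _ hj]
  · simp [hj]

/-- Solutions with prescribed switching times, and their continuations with frozen hysteresis, are
given by the explicit formula. -/
lemma eq_switchedSolution (hc : 0 ≤ c) (hh : 0 ≤ h₁) {T : ℝ} (hT : 0 ≤ T)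
    (ht : ∀ k < n, 0 ≤ t k ∧ t k ≤ T) {u v : ℤ → ℝ → ℝ} (hu0 : ∀ j : ℤ, u j 0 = -c * (j : ℝ) ^ 2)
    {S : Finset ℝ} (hu : SolvesLattice (prescribedConfig h₁ n t) S 0 T u)
    (hv : IsFrozenContinuation (frozenConfig h₁ n) T u v) :
    (∀ j, u j T = switchedSolution c h₁ n t j T) ∧
      ∀ j, ∀ s, T ≤ s → v j s = switchedSolution c h₁ n t j s := by
  have ht0 : ∀ k < n, 0 ≤ t k := fun k hk => (ht k hk).1
  have h1 : ∀ j, u j T = switchedSolution c h₁ n t j T := fun j =>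
    hu.unique (switchedSolution_solves hc hh ht0 le_rfl)
      (fun j => by rw [hu0, switchedSolution_initial ht0]) (right_mem_Icc.2 hT) j
  refine ⟨h1, fun j s hs => ?_⟩
  have hw : SolvesLattice (fun j _ => frozenConfig h₁ n j) ((Finset.range n).image t) T (s + 1)
      (switchedSolution c h₁ n t) :=
    (switchedSolution_solves hc hh ht0 hT).congr fun r hr j =>
      prescribedConfig_eq_frozenConfig fun k hk => (ht k hk).2.trans hr.1.le
  exact (hv.solves (s + 1) (by linarith)).unique hw (fun j => by rw [hv.initial, h1])
    ⟨hs, by linarith⟩ j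

end

section

/-! ### Well-posedness of the problem with hysteresis -/

variable {c h₁ a E : ℝ} {n : ℕ} {t : ℕ → ℝ} {u u' v : ℤ → ℝ → ℝ}

lemma hysteresis_of_neg {w : ℝ → ℝ} {s : ℝ} (h : ∀ r ∈ Icc 0 s, w r < 0) :
    hysteresis h₁ w s = h₁ := if_pos h

lemma hysteresis_of_nonneg {w : ℝ → ℝ} {r s : ℝ} (hr : r ∈ Icc 0 s) (h : 0 ≤ w r) :
    hysteresis h₁ w s = 0 := if_neg fun h' => (h' r hr).not_ge h

lemma abs_hysteresis_sub_le (hh : 0 ≤ h₁) (w : ℝ → ℝ) (s : ℝ) : |hysteresis h₁ w s - h₁| ≤ h₁ := by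
  unfold hysteresis
  split_ifs <;> simp [abs_of_nonneg hh, hh]

namespace IsHysteresisSolution

lemma continuousOn (hu : IsHysteresisSolution c h₁ u) (j : ℤ) : ContinuousOn (u j) (Ici 0) := by
  intro x (hx : 0 ≤ x)
  obtain ⟨S, hS⟩ := hu.solves (x + 1) (by linarith)
  refine ((hS.continuousOn j) x ⟨hx, by linarith⟩).mono_of_mem_nhdsWithin ?_
  rw [← Ici_inter_Iic]
  exact inter_mem_nhdsWithin _ (Iic_mem_nhds (by linarith))

/-- On bounded time intervals the nodes far from the origin stay below the threshold. -/
lemma exists_forall_neg (hu : IsHysteresisSolution c h₁ u) (hc : 0 < c) (hh : 0 ≤ h₁) (T : ℝ) :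
    ∃ R : ℕ, ∀ j : ℤ, R ≤ j.natAbs → ∀ s ∈ Icc 0 T, u j s < 0 := by
  rcases lt_or_ge 0 T with hT | hT
  swap
  · refine ⟨1, fun j hj s hs => ?_⟩
    have : s = 0 := le_antisymm (hs.2.trans hT) hs.1
    have hj0 : (j : ℝ) ≠ 0 := by
      have : j ≠ 0 := by omega
      exact_mod_cast this
    rw [this, hu.initial]
    have : 0 < (j : ℝ) ^ 2 := by positivity
    nlinarith
  obtain ⟨S, hS⟩ := hu.solves T hT
  set M := |h₁ - 2 * c| * T + h₁ / 4 * (exp (4 * T) - 1)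
  obtain ⟨R, hR⟩ := exists_nat_gt (M / c)
  refine ⟨R + 1, fun j hj s hs => ?_⟩
  have hw := switchedSolution_solves (n := 0) (t := fun _ => 0) hc.le hh (by simp)
    (le_refl (0 : ℝ)) (t₁ := T)
  have h := (hS.sub hw).abs_le (B := h₁) (fun j => by
    rw [hu.initial, switchedSolution_initial (by simp), sub_self]) hh
    (fun s _ j => by simpa [prescribedConfig] using abs_hysteresis_sub_le hh (u j) s) hs j
  rw [sub_zero] at h
  have h1 : h₁ / 4 * (exp (4 * s) - 1) ≤ h₁ / 4 * (exp (4 * T) - 1) := by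
    gcongr
    exact hs.2
  have h2 := (le_abs_self _).trans (h.trans h1)
  simp only [switchedSolution, Nat.cast_zero, neg_zero, Finset.Ioo_self, Finset.sum_empty,
    mul_zero, sub_zero] at h2
  have h3 : (h₁ - 2 * c) * s ≤ |h₁ - 2 * c| * T :=
    mul_le_mul (le_abs_self _) hs.2 hs.1 (abs_nonneg _)
  have h4 : (R : ℝ) + 1 ≤ |(j : ℝ)| := by
    rw [← Int.cast_abs, Int.abs_eq_natAbs]
    exact_mod_cast hj
  have h5 : (R : ℝ) < (j : ℝ) ^ 2 := by rw [← sq_abs]; nlinarith [R.cast_nonneg (α := ℝ)]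
  rw [div_lt_iff₀ hc] at hR
  have h6 := mul_lt_mul_of_pos_right h5 hc
  simp only [M] at hR
  linarith

lemma eventually_hysteresis_eq (hu : IsHysteresisSolution c h₁ u)
    (hu' : IsHysteresisSolution c h₁ u') {x : ℝ} (hx : 0 ≤ x) {j : ℤ}
    (h : ∀ r ∈ Icc 0 x, u j r = u' j r) :
    ∀ᶠ z in 𝓝[>] x, ∀ r ∈ Ioc x z, hysteresis h₁ (u j) r = hysteresis h₁ (u' j) r := by
  by_cases hneg : ∀ r ∈ Icc 0 x, u j r < 0
  · have hev : ∀ w, IsHysteresisSolution c h₁ w → w j x < 0 → ∀ᶠ r in 𝓝[>] x, w j r < 0 :=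
      fun w hw hwx => (((hw.continuousOn j) x hx).mono_left
        (nhdsWithin_mono x fun r (hr : x < r) => hx.trans hr.le)).eventually_lt_const hwx
    have hx' : x ∈ Icc 0 x := right_mem_Icc.2 hx
    have h1 := (hev u hu (hneg x hx')).and (hev u' hu' (h x hx' ▸ hneg x hx'))
    obtain ⟨y, hy, hsub⟩ := mem_nhdsGT_iff_exists_Ioo_subset.1 h1
    filter_upwards [Ioo_mem_nhdsGT hy] with z hz r hr
    have h2 : ∀ q ∈ Icc 0 r, u j q < 0 ∧ u' j q < 0 := fun q hq => by
      rcases le_or_gt q x with hqx | hqx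
      · exact ⟨hneg q ⟨hq.1, hqx⟩, h q ⟨hq.1, hqx⟩ ▸ hneg q ⟨hq.1, hqx⟩⟩
      · exact hsub ⟨hqx, (hq.2.trans hr.2).trans_lt hz.2⟩
    rw [hysteresis_of_neg fun q hq => (h2 q hq).1, hysteresis_of_neg fun q hq => (h2 q hq).2]
  · push Not at hneg
    obtain ⟨r₀, hr₀, hur⟩ := hneg
    refine Eventually.of_forall fun z r hr => ?_
    have hr' : r₀ ∈ Icc 0 r := ⟨hr₀.1, hr₀.2.trans hr.1.le⟩
    rw [hysteresis_of_nonneg hr' hur, hysteresis_of_nonneg hr' (h r₀ hr₀ ▸ hur)]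

/-- The solution of the problem with hysteresis is unique: two solutions that agree up to some time
have the same switched nodes for a short time after it, because only finitely many nodes are close
to the threshold, so that they solve the same linear problem. -/
theorem unique (hu : IsHysteresisSolution c h₁ u) (hu' : IsHysteresisSolution c h₁ u')
    (hc : 0 < c) (hh : 0 ≤ h₁) (j : ℤ) {s : ℝ} (hs : 0 ≤ s) : u j s = u' j s := by
  suffices H : ∀ T > 0, Icc 0 T ⊆ {τ | ∀ r ∈ Icc 0 τ, ∀ j, u j r = u' j r} from
    H (s + 1) (by linarith) ⟨hs, by linarith⟩ s (right_mem_Icc.2 hs) j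
  intro T hT
  have h00 : ∀ r ∈ Icc (0 : ℝ) 0, ∀ j, u j r = u' j r := fun r hr j => by
    rw [le_antisymm hr.2 hr.1, hu.initial, hu'.initial]
  obtain ⟨S, hS⟩ := hu.solves T hT
  obtain ⟨S', hS'⟩ := hu'.solves T hT
  obtain ⟨R, hR⟩ := hu.exists_forall_neg hc hh T
  obtain ⟨R', hR'⟩ := hu'.exists_forall_neg hc hh T
  refine IsClosed.Icc_subset_of_forall_exists_gt ?_ h00 ?_
  · refine isClosed_of_closure_subset fun τ hτ => ?_
    have hτT : τ ∈ Icc 0 T := closure_minimal inter_subset_right isClosed_Icc hτ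
    refine ⟨?_, hτT⟩
    rcases hτT.1.eq_or_lt with h0 | h0
    · rw [← h0]; exact h00
    intro r hr j
    have hcl : IsClosed {r ∈ Icc 0 T | u j r - u' j r = 0} :=
      ((hS.continuousOn j).sub (hS'.continuousOn j)).preimage_isClosed_of_isClosed isClosed_Icc
        isClosed_singleton
    have hsub : Ico 0 τ ⊆ {r ∈ Icc 0 T | u j r - u' j r = 0} := fun q hq => by
      obtain ⟨τ', hτ', hmem⟩ := mem_closure_iff.1 hτ _ isOpen_Ioi hq.2
      exact ⟨⟨hq.1, hq.2.le.trans hτT.2⟩, sub_eq_zero.2 (hmem.1 q ⟨hq.1, le_of_lt hτ'⟩ j)⟩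
    have := closure_minimal hsub hcl
    rw [closure_Ico h0.ne] at this
    exact sub_eq_zero.1 (this hr).2
  · rintro x ⟨hx, hx0, hxT⟩ y (hy : x < y)
    have hfin := (Finset.eventually_all (Finset.Ioo (-(max R R') : ℤ) (max R R'))).2
      fun j _ => hu.eventually_hysteresis_eq hu' hx0 (j := j) fun r hr => hx r hr j
    obtain ⟨z, hz, hzx⟩ := (hfin.and (Ioo_mem_nhdsGT (lt_min hy hxT))).exists
    have hzT : z ≤ T := hzx.2.le.trans (min_le_right _ _)
    have hH : ∀ r ∈ Ioo x z, ∀ j, hysteresis h₁ (u j) r = hysteresis h₁ (u' j) r := by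
      intro r hr j
      by_cases hj : j ∈ Finset.Ioo (-(max R R') : ℤ) (max R R')
      · exact hz j hj r ⟨hr.1, hr.2.le⟩
      · rw [Finset.mem_Ioo] at hj
        have hsub : ∀ q ∈ Icc 0 r, q ∈ Icc 0 T := fun q hq => ⟨hq.1, hq.2.trans (hr.2.le.trans hzT)⟩
        rw [hysteresis_of_neg fun q hq => hR j (by omega) q (hsub q hq),
          hysteresis_of_neg fun q hq => hR' j (by omega) q (hsub q hq)]
    refine ⟨z, fun r hr j => ?_, hzx.1, hzx.2.le.trans (min_le_left _ _)⟩
    rcases le_or_gt r x with hrx | hrx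
    · exact hx r ⟨hr.1, hrx⟩ j
    · exact ((hS.mono hx0 hzT).congr hH).unique (hS'.mono hx0 hzT)
        (fun j => hx x (right_mem_Icc.2 hx0) j) ⟨hrx.le, hr.2⟩ j

lemma reflect (hu : IsHysteresisSolution c h₁ u) :
    IsHysteresisSolution c h₁ fun j => u (-j) where
  initial j := by simp [hu.initial]
  solves T hT := by
    obtain ⟨S, hS⟩ := hu.solves T hT
    refine ⟨S, fun j => hS.continuousOn (-j), ?_, fun s hs hsS j => ?_⟩
    · obtain ⟨A, α, hA⟩ := hS.growth
      exact ⟨A, α, fun j s hs => by simpa using hA (-j) s hs⟩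
    · have := hS.hasDerivAt s hs hsS (-j)
      refine this.congr_deriv ?_
      simp only [latticeLaplacian]
      rw [show -(j + 1) = -j - 1 by ring, show -(j - 1) = -j + 1 by ring]
      ring

lemma eq_natAbs (hu : IsHysteresisSolution c h₁ u) (hc : 0 < c) (hh : 0 ≤ h₁) (j : ℤ) {s : ℝ}
    (hs : 0 ≤ s) : u j s = u j.natAbs s := by
  rcases Int.natAbs_eq j with h | h
  · rw [← h]
  · have := hu.unique hu.reflect hc hh j.natAbs hs
    rw [← h] at this
    exact this.symm

lemma hysteresis_eq_natAbs (hu : IsHysteresisSolution c h₁ u) (hc : 0 < c) (hh : 0 ≤ h₁) (j : ℤ)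
    (s : ℝ) : hysteresis h₁ (u j) s = hysteresis h₁ (u j.natAbs) s := by
  unfold hysteresis
  congr 1
  refine propext (forall₂_congr fun r hr => ?_)
  rw [hu.eq_natAbs hc hh j hr.1]

end IsHysteresisSolution

lemma IsSwitchingMoment.neg {w : ℝ → ℝ} {s r : ℝ} (h : IsSwitchingMoment w s) (hr : 0 ≤ r)
    (hrs : r < s) : w r < 0 := by
  by_contra hw
  exact (h.2 ⟨hr, not_lt.1 hw⟩).not_gt hrs

lemma IsSwitchingMoment.eq_zero {w : ℝ → ℝ} {s : ℝ} (h : IsSwitchingMoment w s)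
    (hw : ContinuousOn w (Ici 0)) (h0 : w 0 < 0) : w s = 0 := by
  have hs : 0 < s := h.1.1.lt_of_ne fun h' => by
    have := h.1.2
    rw [← h'] at this
    linarith
  refine le_antisymm ?_ h.1.2
  have ht : Tendsto w (𝓝[Ico 0 s] s) (𝓝 (w s)) :=
    (hw s hs.le).mono_left (nhdsWithin_mono _ fun r hr => hr.1)
  have : (𝓝[Ico 0 s] s).NeBot := by
    rw [← mem_closure_iff_nhdsWithin_neBot, closure_Ico hs.ne]
    exact right_mem_Icc.2 hs.le
  exact le_of_tendsto ht (eventually_mem_nhdsWithin.mono fun r hr => (h.neg hr.1 hr.2).le)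

/-- Switching times within `E √k` of `a k²` are ordered from some index on. -/
lemma exists_forall_lt (ha : 0 < a) (E : ℝ) :
    ∃ N₁ ≥ 1, ∀ l ≥ N₁, ∀ k < l, ∀ t : ℕ → ℝ, |t k - a * (k : ℝ) ^ 2| ≤ E * √(k : ℝ) →
      |t l - a * (l : ℝ) ^ 2| ≤ E * √(l : ℝ) → t k < t l := by
  obtain ⟨N, hN⟩ := exists_nat_gt ((2 * |E| / a) ^ 2)
  refine ⟨N + 1, by omega, fun l hl k hk t h1 h2 => ?_⟩
  have hl1 : (N : ℝ) + 1 ≤ l := by exact_mod_cast hl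
  have hk1 : (k : ℝ) + 1 ≤ l := by exact_mod_cast hk
  have hk0 : (0 : ℝ) ≤ k := k.cast_nonneg
  have hsq : √(l : ℝ) ^ 2 = l := sq_sqrt (by linarith)
  have hlt : 2 * |E| / a < √l := lt_sqrt_of_sq_lt (by linarith)
  rw [div_lt_iff₀ ha] at hlt
  have hpos : 0 < √(l : ℝ) := sqrt_pos.2 (by linarith)
  have hkl : √(k : ℝ) ≤ √l := sqrt_le_sqrt (by linarith)
  have e1 : E * √k ≤ |E| * √l := mul_le_mul (le_abs_self E) hkl (sqrt_nonneg _) (abs_nonneg _)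
  have e2 : E * √l ≤ |E| * √l := mul_le_mul_of_nonneg_right (le_abs_self E) hpos.le
  have e3 : 2 * |E| * √l < a * l := by
    have := mul_lt_mul_of_pos_right hlt hpos
    rwa [mul_right_comm √(l : ℝ), ← sq, hsq, mul_comm (l : ℝ)] at this
  have e4 : a * l ≤ a * (l : ℝ) ^ 2 - a * (k : ℝ) ^ 2 := by
    rw [← mul_sub]; gcongr; nlinarith
  have h1' := (abs_le.1 h1).2
  have h2' := (abs_le.1 h2).1
  linarith

namespace InductiveHypothesis

/-- Under the inductive hypothesis the hysteresis acts by switching the nodes `±k`, `k < n`, at the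
times `t k`. -/
lemma hysteresis_eq (hi : InductiveHypothesis a E u t n) (hu : IsHysteresisSolution c h₁ u)
    (hc : 0 < c) (hh : 0 ≤ h₁) {s : ℝ} (hs : s ≤ t (n - 1)) (j : ℤ) :
    hysteresis h₁ (u j) s = prescribedConfig h₁ n t j s := by
  rw [hu.hysteresis_eq_natAbs hc hh, prescribedConfig]
  split_ifs with h
  · have hm := hi.switch _ h.1
    exact hysteresis_of_nonneg ⟨hm.1.1, h.2⟩ hm.1.2
  · refine hysteresis_of_neg fun r hr => ?_
    rcases lt_or_ge j.natAbs n with hj | hj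
    · have : s < t j.natAbs := by
        by_contra h'
        exact h ⟨hj, not_lt.1 h'⟩
      exact (hi.switch _ hj).neg hr.1 (hr.2.trans_lt this)
    · exact hi.later _ hj r ⟨hr.1, hr.2.trans hs⟩

/-- If the inductive hypothesis holds for some `m > n`, then the switching time of the node `n` is a
candidate, since the frozen continuation coincides with the solution until the node `n`
switches. -/
lemma isCandidate {m : ℕ} {t' : ℕ → ℝ} {N₁ : ℕ}
    (hN₁ : ∀ l ≥ N₁, ∀ k < l, ∀ t : ℕ → ℝ, |t k - a * (k : ℝ) ^ 2| ≤ E * √(k : ℝ) →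
      |t l - a * (l : ℝ) ^ 2| ≤ E * √(l : ℝ) → t k < t l)
    (hn : N₁ < n) (hn1 : 1 ≤ n) (hnm : n < m) (hi : InductiveHypothesis a E u t n)
    (hi' : InductiveHypothesis a E u t' m) (hu : IsHysteresisSolution c h₁ u)
    (hc : 0 < c) (hh : 0 ≤ h₁)
    (hv : IsFrozenContinuation (fun j => hysteresis h₁ (u j) (t (n - 1))) (t (n - 1)) u v) :
    IsCandidate a E n (t (n - 1)) (v n) (t' n) := by
  have hsw := hi'.switch n hnm
  have htt : ∀ k < n, t k = t' k := fun k hk =>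
    (hi.switch k hk).unique (hi'.switch k (hk.trans hnm))
  have hlt : t (n - 1) < t' n := by
    by_contra h
    exact (hi.later n le_rfl (t' n) ⟨hsw.1.1, not_lt.1 h⟩).not_ge hsw.1.2
  have h0 : 0 ≤ t (n - 1) := (hi.switch _ (by omega)).1.1
  have hle : ∀ k < n, t k ≤ t (n - 1) := fun k hk => by
    rcases (Nat.le_sub_one_of_lt hk).eq_or_lt with h | h
    · rw [h]
    · exact (hN₁ _ (by omega) k h t (hi.near k hk) (hi.near _ (by omega))).le
  have hlater : ∀ k ≥ n, ∀ r ∈ Ico 0 (t' n), u k r < 0 := fun k hk r hr => by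
    rcases hk.eq_or_lt with rfl | hk
    · exact hsw.neg hr.1 hr.2
    rcases lt_or_ge k m with hkm | hkm
    · exact (hi'.switch k hkm).neg hr.1
        (hr.2.trans (hN₁ k (by omega) n hk t' (hi'.near n hnm) (hi'.near k hkm)))
    · have : t' n ≤ t' (m - 1) := by
        rcases (Nat.le_sub_one_of_lt hnm).eq_or_lt with h | h
        · rw [← h]
        · exact (hN₁ _ (by omega) n h t' (hi'.near n hnm) (hi'.near _ (by omega))).le
      exact hi'.later k hkm r ⟨hr.1, hr.2.le.trans this⟩
  obtain ⟨S, hS⟩ := hu.solves (t' n) (h0.trans_lt hlt)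
  have hfrozen : ∀ r ∈ Ioo (t (n - 1)) (t' n), ∀ j,
      hysteresis h₁ (u j) r = hysteresis h₁ (u j) (t (n - 1)) := fun r hr j => by
    rw [hu.hysteresis_eq_natAbs hc hh, hu.hysteresis_eq_natAbs hc hh j (t (n - 1))]
    rcases lt_or_ge j.natAbs n with hj | hj
    · have hm := hi.switch _ hj
      rw [hysteresis_of_nonneg ⟨hm.1.1, hle _ hj⟩ hm.1.2,
        hysteresis_of_nonneg ⟨hm.1.1, (hle _ hj).trans hr.1.le⟩ hm.1.2]
    · rw [hysteresis_of_neg fun q hq => hlater _ hj q ⟨hq.1, hq.2.trans_lt hlt⟩,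
        hysteresis_of_neg fun q hq => hlater _ hj q ⟨hq.1, hq.2.trans_lt hr.2⟩]
  refine ⟨hlt, hi'.near n hnm, ?_⟩
  rw [(hv.solves (t' n) hlt).unique ((hS.mono h0 le_rfl).congr hfrozen) hv.initial
    (right_mem_Icc.2 hlt.le)]
  refine hsw.eq_zero (hu.continuousOn n) ?_
  have : (0 : ℝ) < n := by exact_mod_cast hn1
  rw [hu.initial]
  simp only [Int.cast_natCast]
  nlinarith [pow_pos this 2]

end InductiveHypothesis

/-- Since the problem has only one solution, either the inductive hypothesis fails for all large `n`,
or it holds for arbitrarily large ones; in the latter case every node switches in time. -/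
lemma exists_forall_isCandidate (hc : 0 < c) (hh : 0 ≤ h₁) (ha : 0 < a) (E : ℝ) :
    ∃ n₀ : ℕ, ∀ n ≥ n₀, ∀ (t : ℕ → ℝ) (u v : ℤ → ℝ → ℝ), IsHysteresisSolution c h₁ u →
      InductiveHypothesis a E u t n →
      IsFrozenContinuation (fun j => hysteresis h₁ (u j) (t (n - 1))) (t (n - 1)) u v →
      ∃ tn, IsCandidate a E n (t (n - 1)) (v n) tn := by
  obtain ⟨N₁, -, hN₁⟩ := exists_forall_lt ha E
  by_cases hinf : ∀ N : ℕ, ∃ m > N, ∃ u t, IsHysteresisSolution c h₁ u ∧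
    InductiveHypothesis a E u t m
  · refine ⟨N₁ + 1, fun n hn t u v hu hi hv => ?_⟩
    obtain ⟨m, hm, u', t', hu', hi'⟩ := hinf n
    have huu : ∀ j, ∀ s, 0 ≤ s → u' j s = u j s := fun j s hs => hu'.unique hu hc hh j hs
    have hi'' : InductiveHypothesis a E u t' m := by
      refine ⟨fun k hk => ?_, hi'.near, fun j hj s hs => huu j s hs.1 ▸ hi'.later j hj s hs⟩
      have := hi'.switch k hk
      unfold IsSwitchingMoment at this ⊢
      convert this using 1
      ext r
      exact and_congr_right fun hr => by rw [huu k r hr]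
    exact ⟨t' n, hi.isCandidate hN₁ (by omega) (by omega) hm hi'' hu hc hh hv⟩
  · push Not at hinf
    obtain ⟨N, hN⟩ := hinf
    exact ⟨N + 1, fun n hn t u v hu hi _ => absurd hi (hN n (by omega) u t hu)⟩

end

section

/-! ### The continuum limit -/

/-- The limit of `n G_{n-k}(a n² - a k²)` for `k / n → x`. -/
def profile (a x : ℝ) : ℝ := exp (-(1 - x) / (4 * a * (1 + x))) / √(4 * π * a * (1 - x ^ 2))

/-- The limit of minus the spatial derivative of the source solution, at the node `n` and the time
`a n² - a k²`, for `k / n → x`. -/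
def slopeProfile (a x : ℝ) : ℝ := 1 / 2 - halfErf √((1 - x) / (4 * a * (1 + x)))

variable {a : ℝ}

lemma profile_eq_gaussKernel (ha : 0 < a) {x : ℝ} (hx : x ∈ Ioo (-1 : ℝ) 1) :
    profile a x = gaussKernel (1 - x) (a * (1 - x ^ 2)) := by
  have h1 : 0 < 1 - x := by linarith [hx.2]
  have h2 : 0 < 1 + x := by linarith [hx.1]
  unfold profile gaussKernel
  rw [show (1 : ℝ) - x ^ 2 = (1 - x) * (1 + x) by ring, ← mul_assoc (4 * π)]
  congr 2
  field_simp

lemma slopeProfile_nonneg (a x : ℝ) : 0 ≤ slopeProfile a x :=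
  sub_nonneg.2 (halfErf_le_half (sqrt_nonneg _))

lemma slopeProfile_le_half (a x : ℝ) : slopeProfile a x ≤ 1 / 2 :=
  sub_le_self _ (halfErf_nonneg (sqrt_nonneg _))

lemma monotoneOn_slopeProfile (ha : 0 < a) : MonotoneOn (slopeProfile a) (Ioc (-1) 1) := by
  intro x hx y hy hxy
  refine sub_le_sub_left (monotone_halfErf (sqrt_le_sqrt ?_)) _
  have h1 : 0 < 1 + x := by linarith [hx.1]
  have h2 : 0 ≤ 1 - y := by linarith [hy.2]
  gcongr
  linarith

lemma continuous_halfErf : Continuous halfErf :=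
  continuous_iff_continuousAt.2 fun z => (hasDerivAt_halfErf z).continuousAt

lemma intervalIntegrable_slopeProfile (a p q : ℝ) :
    IntervalIntegrable (slopeProfile a) volume p q := by
  have hm : Measurable (slopeProfile a) := by
    have := continuous_halfErf.measurable
    unfold slopeProfile
    fun_prop
  refine (intervalIntegrable_const (c := (1 / 2 : ℝ))).mono_fun hm.aestronglyMeasurable
    (ae_of_all _ fun x => ?_)
  simp only [Real.norm_eq_abs, abs_of_nonneg (slopeProfile_nonneg a x)]
  exact (slopeProfile_le_half a x).trans (le_abs_self _)

/-- In the continuum limit the vanishing of the time derivative at the switching front implies that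
of the space derivative: `(1 + x) * slopeProfile a x` is an antiderivative of the sum of the two
profiles. -/
lemma integral_slopeProfile (ha : 0 < a) (hK : IntervalIntegrable (profile a) volume (-1) 1) :
    ∫ x in (-1 : ℝ)..1, slopeProfile a x = 1 - ∫ x in (-1 : ℝ)..1, profile a x := by
  have hd : ∀ x ∈ Ioo (-1 : ℝ) 1, HasDerivAt (fun x => (1 + x) * slopeProfile a x)
      (slopeProfile a x + profile a x) x := by
    intro x hx
    have h1 : 0 < 1 - x := by linarith [hx.2]
    have h2 : 0 < 1 + x := by linarith [hx.1]
    have hq0 : 0 < (1 - x) / (4 * a * (1 + x)) := by positivity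
    have hq : HasDerivAt (fun x => (1 - x) / (4 * a * (1 + x))) (-1 / (2 * a * (1 + x) ^ 2)) x := by
      have := ((hasDerivAt_id x).const_sub 1).div
        (((hasDerivAt_id x).const_add 1).const_mul (4 * a)) (by simp only [id]; positivity)
      refine this.congr_deriv ?_
      simp only [id]
      field_simp
      ring
    have := ((hasDerivAt_id x).const_add 1).mul
      (((hasDerivAt_halfErf _).comp x (hq.sqrt hq0.ne')).const_sub (1 / 2))
    refine this.congr_deriv ?_
    have hs : √(4 * π * a * (1 - x ^ 2))
        = √π * (4 * a * (1 + x) * √((1 - x) / (4 * a * (1 + x)))) := by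
      rw [show 4 * π * a * (1 - x ^ 2)
          = π * ((4 * a * (1 + x)) ^ 2 * ((1 - x) / (4 * a * (1 + x)))) by field_simp; ring,
        sqrt_mul pi_pos.le, sqrt_mul (by positivity), sqrt_sq (by positivity)]
    have hp : 0 < √π := sqrt_pos.2 pi_pos
    have hz : 0 < √((1 - x) / (4 * a * (1 + x))) := sqrt_pos.2 hq0
    unfold profile
    rw [hs, sq_sqrt hq0.le, ← neg_div]
    simp only [id, slopeProfile, Function.comp]
    generalize √((1 - x) / (4 * a * (1 + x))) = z at *
    field_simp
    ring
  have hcont : ContinuousOn (fun x => (1 + x) * slopeProfile a x) (Icc (-1) 1) := by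
    intro x hx
    rcases hx.1.eq_or_lt with h | h
    · rw [← h]
      refine ContinuousAt.continuousWithinAt ?_
      have h0 : (1 + (-1 : ℝ)) * slopeProfile a (-1) = 0 := by norm_num
      simp only [ContinuousAt, h0]
      refine squeeze_zero_norm (a := fun x : ℝ => |1 + x| * (1 / 2)) (fun x => ?_) ?_
      · rw [norm_mul, Real.norm_eq_abs, Real.norm_eq_abs, abs_of_nonneg (slopeProfile_nonneg a x)]
        exact mul_le_mul_of_nonneg_left (slopeProfile_le_half a x) (abs_nonneg _)
      · have : Continuous fun x : ℝ => |1 + x| * (1 / 2) := by fun_prop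
        simpa using this.tendsto (-1)
    · refine ContinuousAt.continuousWithinAt ?_
      have h2 : 4 * a * (1 + x) ≠ 0 := by
        have : 0 < 1 + x := by linarith
        positivity
      have hq : ContinuousAt (fun x => √((1 - x) / (4 * a * (1 + x)))) x := by
        refine ContinuousAt.sqrt (ContinuousAt.div (by fun_prop) (by fun_prop) h2)
      exact ContinuousAt.mul (by fun_prop)
        (continuousAt_const.sub (continuous_halfErf.continuousAt.comp hq))
  have h := integral_eq_sub_of_hasDerivAt_of_le (by norm_num : (-1 : ℝ) ≤ 1) hcont hd
    ((intervalIntegrable_slopeProfile a _ _).add hK)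
  rw [intervalIntegral.integral_add (intervalIntegrable_slopeProfile a _ _) hK] at h
  have h1 : slopeProfile a 1 = 1 / 2 := by simp [slopeProfile]
  rw [h1] at h
  norm_num at h
  linarith

/-- The sum is below the integral because the profile is increasing. -/
lemma sum_slopeProfile_le (ha : 0 < a) {N : ℕ} (hN : 1 ≤ N) :
    ∑ k ∈ Finset.Ioo (-N : ℤ) N, slopeProfile a (k / N)
      ≤ N * ∫ x in (-1 : ℝ)..1, slopeProfile a x := by
  have hN0 : (0 : ℝ) < N := by exact_mod_cast hN
  have hN1 : (1 : ℝ) ≤ N := by exact_mod_cast hN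
  have hcast : ((2 * N - 1 : ℕ) : ℝ) = 2 * N - 1 := by
    rw [Nat.cast_sub (by omega)]; push_cast; ring
  have hmono : MonotoneOn (fun x => slopeProfile a (x / N))
      (Icc (-N + 1) (-N + 1 + (2 * N - 1 : ℕ))) := by
    rw [hcast]
    intro x hx y hy hxy
    refine monotoneOn_slopeProfile ha ⟨?_, ?_⟩ ⟨?_, ?_⟩ (by gcongr)
    · rw [lt_div_iff₀ hN0]; linarith [hx.1]
    · rw [div_le_one hN0]; linarith [hx.2]
    · rw [lt_div_iff₀ hN0]; linarith [hy.1]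
    · rw [div_le_one hN0]; linarith [hy.2]
  have h1 := hmono.sum_le_integral
  have h2 : ∑ k ∈ Finset.Ioo (-N : ℤ) N, slopeProfile a (k / N)
      = ∑ i ∈ Finset.range (2 * N - 1), slopeProfile a ((-N + 1 + i) / N) := by
    symm
    refine Finset.sum_bij' (fun i _ => (-N + 1 + i : ℤ)) (fun k _ => (k + N - 1).toNat)
      ?_ ?_ ?_ ?_ ?_
    · intro i hi; rw [Finset.mem_range] at hi; rw [Finset.mem_Ioo]; omega
    · intro k hk; rw [Finset.mem_Ioo] at hk; rw [Finset.mem_range]; omega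
    · intro i hi; omega
    · intro k hk; rw [Finset.mem_Ioo] at hk; omega
    · intro i hi; push_cast; rfl
  rw [h2]
  refine h1.trans ?_
  rw [hcast, intervalIntegral.integral_comp_div _ hN0.ne', smul_eq_mul]
  refine mul_le_mul_of_nonneg_left ?_ hN0.le
  rw [show (-(N : ℝ) + 1 + (2 * N - 1)) / N = 1 by field_simp; ring]
  have hle : -1 ≤ (-(N : ℝ) + 1) / N := by rw [le_div_iff₀ hN0]; linarith
  have hle1 : (-(N : ℝ) + 1) / N ≤ 1 := by rw [div_le_one hN0]; linarith
  rw [← integral_add_adjacent_intervals (intervalIntegrable_slopeProfile a (-1) ((-(N : ℝ) + 1) / N))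
    (intervalIntegrable_slopeProfile a _ 1)]
  exact le_add_of_nonneg_left (integral_nonneg hle fun x _ => slopeProfile_nonneg a x)

/-- Diffusive scaling of the heat kernel. -/
lemma tendsto_mul_heatKernel {ι : Type*} {l : Filter ι} {N m τ : ι → ℝ} {μ σ : ℝ}
    (hN : Tendsto N l atTop) (hm : Tendsto (fun i => m i / N i) l (𝓝 μ))
    (hτ : Tendsto (fun i => τ i / N i ^ 2) l (𝓝 σ)) (hσ : 0 < σ) :
    Tendsto (fun i => N i * heatKernel (m i) (τ i)) l (𝓝 (gaussKernel μ σ)) := by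
  have hg : Tendsto (fun i => gaussKernel (m i / N i) (τ i / N i ^ 2)) l (𝓝 (gaussKernel μ σ)) := by
    unfold gaussKernel
    refine Tendsto.div (((hm.pow 2).neg.div (hτ.const_mul 4) (by positivity)).rexp)
      ((hτ.const_mul (4 * π)).sqrt) (sqrt_pos.2 (by positivity)).ne'
  have hpos : ∀ᶠ i in l, 0 < N i ∧ 0 < τ i := by
    filter_upwards [hN.eventually_gt_atTop 0, hτ.eventually_const_lt hσ] with i h1 h2
    exact ⟨h1, (div_pos_iff_of_pos_right (by positivity)).1 h2⟩
  have herr : Tendsto (fun i => 100 / ((τ i / N i ^ 2) * √(τ i / N i ^ 2)) * ((N i)⁻¹ * (N i)⁻¹)) l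
      (𝓝 0) := by
    have := (tendsto_const_nhds (x := (100 : ℝ))).div (hτ.mul hτ.sqrt)
      (mul_pos hσ (sqrt_pos.2 hσ)).ne'
    simpa using this.mul (hN.inv_tendsto_atTop.mul hN.inv_tendsto_atTop)
  have hdiff : Tendsto (fun i => N i * heatKernel (m i) (τ i)
      - gaussKernel (m i / N i) (τ i / N i ^ 2)) l (𝓝 0) := by
    refine squeeze_zero_norm' ?_ herr
    filter_upwards [hpos] with i ⟨h1, h2⟩
    have hs : √(τ i / N i ^ 2) = √(τ i) / N i := by rw [sqrt_div h2.le, sqrt_sq h1.le]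
    have hst : 0 < √(τ i) := sqrt_pos.2 h2
    have e1 : gaussKernel (m i / N i) (τ i / N i ^ 2) = N i * gaussKernel (m i) (τ i) := by
      unfold gaussKernel
      rw [← mul_div_assoc (4 * π), sqrt_div (by positivity), sqrt_sq h1.le,
        show -(m i / N i) ^ 2 / (4 * (τ i / N i ^ 2)) = -m i ^ 2 / (4 * τ i) by field_simp]
      field_simp
    rw [e1, ← mul_sub, norm_mul, Real.norm_eq_abs, Real.norm_eq_abs, abs_of_pos h1]
    calc _ ≤ N i * (100 / (τ i * √(τ i))) := by
          gcongr
          exact abs_heatKernel_sub_gaussKernel_le _ h2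
      _ = _ := by rw [hs]; field_simp
  simpa using hdiff.add hg

/-- A sum over integers as the integral of a step function. -/
lemma lintegral_step {N : ℕ} (hN : 1 ≤ N) (s : Finset ℤ) {H : ℤ → ℝ} (hH : ∀ k ∈ s, 0 ≤ H k) :
    ∫⁻ x : ℝ, ENNReal.ofReal (N * if ⌊N * x⌋ ∈ s then H ⌊N * x⌋ else 0)
      = ENNReal.ofReal (∑ k ∈ s, H k) := by
  have hN0 : (0 : ℝ) < N := by exact_mod_cast hN
  have hpt : ∀ x : ℝ, ENNReal.ofReal (N * if ⌊N * x⌋ ∈ s then H ⌊N * x⌋ else 0)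
      = ∑ k ∈ s, (Ico ((k : ℝ) / N) ((k + 1) / N)).indicator
        (fun _ => ENNReal.ofReal (N * H k)) x := fun x => by
    have hiff : ∀ k : ℤ, x ∈ Ico ((k : ℝ) / N) ((k + 1) / N) ↔ ⌊N * x⌋ = k := fun k => by
      rw [Int.floor_eq_iff, mem_Ico, div_le_iff₀ hN0, lt_div_iff₀ hN0, mul_comm x]
    simp only [indicator_apply, hiff]
    rw [Finset.sum_ite_eq]
    split_ifs <;> simp
  simp_rw [hpt]
  rw [lintegral_finsetSum _ fun k _ => measurable_const.indicator measurableSet_Ico,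
    ENNReal.ofReal_sum_of_nonneg hH]
  refine Finset.sum_congr rfl fun k hk => ?_
  rw [lintegral_indicator_const measurableSet_Ico, Real.volume_Ico, ← ENNReal.ofReal_mul
    (mul_nonneg hN0.le (hH k hk))]
  congr 1
  field_simp
  ring

end

section

variable {a E : ℝ}

/-- The Riemann sums of the profile, formed with the heat kernel of the lattice, are asymptotically
at least its integral, uniformly in the switching times. Only this half is needed, and it is Fatou's
lemma, because the heat kernel is nonnegative. -/
lemma exists_integral_profile_sub_le_sum (ha : 0 < a)
    (hK : IntervalIntegrable (profile a) volume (-1) 1)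
    (hI : 0 < ∫ x in (-1 : ℝ)..1, profile a x) (E : ℝ) {σ₀ : ℝ} {ε : ℝ} (hε : 0 < ε) :
    ∃ N₀ : ℕ, ∀ N ≥ N₀, ∀ t : ℕ → ℝ, (∀ k ≤ N, |t k - a * (k : ℝ) ^ 2| ≤ E * √(k : ℝ)) →
      (∀ k ≤ N, t k ≤ t N) → ∀ i ≤ 1, ∀ σ ∈ Icc 0 σ₀,
      (∫ x in (-1 : ℝ)..1, profile a x) - ε
        ≤ ∑ k ∈ Finset.Ioo (-N : ℤ) N, heatKernel (N + (i : ℕ) - k) (σ + t N - t k.natAbs) := by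
  by_contra hcon
  push Not at hcon
  choose N hN t hnear hord i hi σ hσ hlt using fun p : ℕ => hcon (p + 1)
  have hN1 : ∀ p, 1 ≤ N p := fun p => by have := hN p; omega
  have hNtop : Tendsto (fun p => (N p : ℝ)) atTop atTop :=
    tendsto_natCast_atTop_atTop.comp (tendsto_atTop_mono (fun p => (Nat.le_succ p).trans (hN p))
      tendsto_id)
  have hinv : Tendsto (fun p => ((N p : ℝ))⁻¹) atTop (𝓝 0) := hNtop.inv_tendsto_atTop
  have hN0 : ∀ p, (0 : ℝ) < N p := fun p => by exact_mod_cast hN1 p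
  set H : ℕ → ℤ → ℝ := fun p k =>
    heatKernel (N p + (i p : ℕ) - k) (σ p + t p (N p) - t p k.natAbs)
  have hH : ∀ p, ∀ k ∈ Finset.Ioo (-N p : ℤ) (N p), 0 ≤ H p k := fun p k hk => by
    rw [Finset.mem_Ioo] at hk
    have h1 := hord p k.natAbs (by omega)
    have h2 := heatKernel_nonneg (N p + i p - k) (τ := σ p + t p (N p) - t p k.natAbs)
      (by linarith [(hσ p).1])
    simp only [H]
    push_cast at h2
    exact h2
  set f : ℕ → ℝ → ENNReal := fun p x => ENNReal.ofReal
    (N p * if ⌊N p * x⌋ ∈ Finset.Ioo (-N p : ℤ) (N p) then H p ⌊N p * x⌋ else 0)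
  have hf : ∀ p, Measurable (f p) := fun p => by
    refine ENNReal.measurable_ofReal.comp (measurable_const.mul ?_)
    exact (measurable_from_top (f := fun k : ℤ => if k ∈ Finset.Ioo (-N p : ℤ) (N p) then H p k
      else 0)).comp (Int.measurable_floor.comp (measurable_const.mul measurable_id))
  have hlim : ∀ x ∈ Ioo (-1 : ℝ) 1,
      Tendsto (fun p => f p x) atTop (𝓝 (ENNReal.ofReal (profile a x))) := by
    intro x hx
    have hk : Tendsto (fun p => (⌊N p * x⌋ : ℝ) / N p) atTop (𝓝 x) := by
      rw [tendsto_iff_dist_tendsto_zero]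
      refine squeeze_zero (fun _ => dist_nonneg) (fun p => ?_) hinv
      rw [Real.dist_eq, abs_le]
      have h1 := Int.floor_le (N p * x)
      have h2 := (Int.lt_floor_add_one (N p * x)).le
      have h3 := hN0 p
      constructor
      · rw [le_sub_iff_add_le, le_div_iff₀ h3, add_mul, neg_mul, inv_mul_cancel₀ h3.ne']
        linarith
      · rw [sub_le_iff_le_add, div_le_iff₀ h3, add_mul, inv_mul_cancel₀ h3.ne']
        linarith
    have hmem : ∀ᶠ p in atTop, ⌊N p * x⌋ ∈ Finset.Ioo (-N p : ℤ) (N p) := by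
      filter_upwards [hk.eventually_const_lt hx.1, hk.eventually_lt_const hx.2] with p h1 h2
      rw [lt_div_iff₀ (hN0 p), neg_one_mul] at h1
      rw [div_lt_one (hN0 p)] at h2
      rw [Finset.mem_Ioo]
      exact ⟨by exact_mod_cast h1, by exact_mod_cast h2⟩
    have hm : Tendsto (fun p => (N p + (i p : ℕ) - ⌊N p * x⌋ : ℝ) / N p) atTop (𝓝 (1 - x)) := by
      have h1 : Tendsto (fun p => ((i p : ℕ) : ℝ) * (N p : ℝ)⁻¹) atTop (𝓝 0) := by
        refine squeeze_zero (fun p => by positivity) (fun p => ?_) hinv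
        exact mul_le_of_le_one_left (inv_pos.2 (hN0 p)).le (by exact_mod_cast hi p)
      have h2 := (h1.const_add 1).sub hk
      rw [add_zero] at h2
      refine h2.congr fun p => ?_
      have := (hN0 p).ne'
      field_simp
    have hτ : Tendsto (fun p => (σ p + t p (N p) - t p (⌊N p * x⌋).natAbs) / (N p : ℝ) ^ 2) atTop
        (𝓝 (a * (1 - x ^ 2))) := by
      have h1 : Tendsto (fun p => (σ p + t p (N p) - t p (⌊N p * x⌋).natAbs
          - (a * N p ^ 2 - a * (⌊N p * x⌋ : ℝ) ^ 2)) / (N p : ℝ) ^ 2) atTop (𝓝 0) := by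
        have h2 : Tendsto (fun p => σ₀ * ((N p : ℝ)⁻¹ * (N p : ℝ)⁻¹) + 2 * |E| * (N p : ℝ)⁻¹) atTop
            (𝓝 0) := by
          simpa using ((hinv.mul hinv).const_mul σ₀).add (hinv.const_mul (2 * |E|))
        refine squeeze_zero_norm' ?_ h2
        filter_upwards [hmem] with p hp
        rw [Finset.mem_Ioo] at hp
        have hle : (⌊N p * x⌋).natAbs ≤ N p := by omega
        have hleR : (((⌊N p * x⌋).natAbs : ℕ) : ℝ) ≤ N p := by exact_mod_cast hle
        have hsq : (((⌊N p * x⌋).natAbs : ℕ) : ℝ) ^ 2 = (⌊N p * x⌋ : ℝ) ^ 2 := by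
          rw [Nat.cast_natAbs, Int.cast_abs, sq_abs]
        have e1 := hnear p _ hle
        have e2 := hnear p (N p) le_rfl
        rw [hsq] at e1
        have hs : ∀ y : ℝ, 0 ≤ y → y ≤ N p → E * √y ≤ |E| * N p := fun y hy hyN => by
          have : √y ≤ N p := by
            rw [sqrt_le_left (hN0 p).le]
            have : (1 : ℝ) ≤ N p := by exact_mod_cast hN1 p
            nlinarith
          exact mul_le_mul (le_abs_self E) this (sqrt_nonneg _) (abs_nonneg _)
        have e3 := hs _ (Nat.cast_nonneg _) hleR
        have e4 := hs _ (hN0 p).le le_rfl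
        rw [abs_le] at e1 e2
        rw [norm_div, Real.norm_eq_abs, Real.norm_eq_abs,
          abs_of_pos (by have := hN0 p; positivity : (0 : ℝ) < N p ^ 2),
          div_le_iff₀ (by have := hN0 p; positivity)]
        have h5 : (σ₀ * ((N p : ℝ)⁻¹ * (N p : ℝ)⁻¹) + 2 * |E| * (N p : ℝ)⁻¹) * (N p : ℝ) ^ 2
            = σ₀ + 2 * |E| * N p := by
          have := (hN0 p).ne'
          field_simp
        have h6 := hσ p
        rw [h5, abs_le]
        constructor <;> linarith [h6.1, h6.2]
      have h3 := h1.add (((hk.pow 2).const_sub 1).const_mul a)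
      rw [zero_add] at h3
      refine h3.congr fun p => ?_
      have := (hN0 p).ne'
      field_simp
      ring
    have hx1 : 0 < 1 - x ^ 2 := by nlinarith [hx.1, hx.2]
    have hmain := tendsto_mul_heatKernel hNtop hm hτ (mul_pos ha hx1)
    rw [← profile_eq_gaussKernel ha hx] at hmain
    refine (ENNReal.continuous_ofReal.tendsto _).comp (hmain.congr' ?_)
    filter_upwards [hmem] with p hp
    rw [if_pos hp]
  have hfat := lintegral_liminf_le (u := atTop) (μ := volume.restrict (Ioo (-1 : ℝ) 1)) hf
  rw [setLIntegral_congr_fun measurableSet_Ioo fun x hx => (hlim x hx).liminf_eq] at hfat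
  have hint : ∫⁻ x in Ioo (-1 : ℝ) 1, ENNReal.ofReal (profile a x)
      = ENNReal.ofReal (∫ x in (-1 : ℝ)..1, profile a x) := by
    rw [integral_of_le (by norm_num), ← integral_Ioc_eq_integral_Ioo.symm,
      ofReal_integral_eq_lintegral_ofReal]
    · exact (intervalIntegrable_iff_integrableOn_Ioo_of_le (by norm_num)).1 hK
    · exact ae_of_all _ fun x => by unfold profile; positivity
  have hle : liminf (fun p => ∫⁻ x in Ioo (-1 : ℝ) 1, f p x) atTop
      ≤ ENNReal.ofReal ((∫ x in (-1 : ℝ)..1, profile a x) - ε) := by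
    refine liminf_le_of_le (by isBoundedDefault) fun b hb => ?_
    obtain ⟨p, hp⟩ := hb.exists
    refine hp.trans ((setLIntegral_le_lintegral _ _).trans ?_)
    rw [lintegral_step (hN1 p) _ (hH p)]
    exact ENNReal.ofReal_le_ofReal (hlt p).le
  rw [hint] at hfat
  rcases ENNReal.ofReal_le_ofReal_iff'.1 (hfat.trans hle) with h | h <;> linarith

end

section

/-! ### Sums over the switched nodes -/

variable {a E : ℝ}

lemma sum_Ioo_succ {N : ℕ} (hN : 1 ≤ N) (f : ℤ → ℝ) :
    ∑ k ∈ Finset.Ioo (-(N + 1 : ℕ) : ℤ) (N + 1 : ℕ), f k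
      = f N + f (-N) + ∑ k ∈ Finset.Ioo (-N : ℤ) N, f k := by
  have : Finset.Ioo (-(N + 1 : ℕ) : ℤ) (N + 1 : ℕ)
      = insert (N : ℤ) (insert (-N : ℤ) (Finset.Ioo (-N : ℤ) N)) := by
    ext k
    simp only [Finset.mem_Ioo, Finset.mem_insert]
    omega
  rw [this, Finset.sum_insert, Finset.sum_insert, add_assoc]
  · simp
  · simp only [Finset.mem_Ioo, Finset.mem_insert]
    omega

lemma sum_Ioo_natAbs_le (N : ℕ) {φ : ℕ → ℝ} (hφ : ∀ l, 0 ≤ φ l) :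
    ∑ k ∈ Finset.Ioo (-N : ℤ) N, φ k.natAbs ≤ 2 * ∑ l ∈ Finset.range N, φ l := by
  have hsub : Finset.Ioo (-N : ℤ) N ⊆ (Finset.range N).image (fun l : ℕ => (l : ℤ))
      ∪ (Finset.range N).image (fun l : ℕ => -(l : ℤ)) := fun k hk => by
    rw [Finset.mem_Ioo] at hk
    rw [Finset.mem_union, Finset.mem_image, Finset.mem_image]
    rcases le_total 0 k with h | h
    · exact Or.inl ⟨k.natAbs, Finset.mem_range.2 (by omega), by omega⟩
    · exact Or.inr ⟨k.natAbs, Finset.mem_range.2 (by omega), by omega⟩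
  calc _ ≤ _ := Finset.sum_le_sum_of_subset_of_nonneg hsub fun _ _ _ => hφ _
    _ ≤ ∑ k ∈ (Finset.range N).image (fun l : ℕ => (l : ℤ)), φ k.natAbs
        + ∑ k ∈ (Finset.range N).image (fun l : ℕ => -(l : ℤ)), φ k.natAbs := by
        rw [← Finset.sum_union_inter]
        exact le_add_of_nonneg_right (Finset.sum_nonneg fun _ _ => hφ _)
    _ = _ := by
        rw [Finset.sum_image (by intro x _ y _ h; simpa using h),
          Finset.sum_image (by intro x _ y _ h; simpa using h)]
        simp only [Int.natAbs_natCast, Int.natAbs_neg]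
        ring

lemma sum_Ioo_inv_le (N : ℕ) :
    ∑ k ∈ Finset.Ioo (-N : ℤ) N, ((N - k.natAbs : ℕ) : ℝ)⁻¹ ≤ 2 * (1 + log N) := by
  refine (sum_Ioo_natAbs_le N (φ := fun l => ((N - l : ℕ) : ℝ)⁻¹) fun l => by positivity).trans ?_
  have h := harmonic_le_one_add_log N
  rw [harmonic, ← Finset.sum_range_reflect] at h
  push_cast at h
  gcongr
  refine le_of_eq_of_le (Finset.sum_congr rfl fun l hl => ?_) h
  rw [Finset.mem_range] at hl
  rw [show N - l = N - 1 - l + 1 by omega]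
  push_cast
  rfl

lemma sum_inv_sqrt_le (N : ℕ) : ∑ i ∈ Finset.range N, (√((i + 1 : ℕ) : ℝ))⁻¹ ≤ 2 * √N := by
  induction N with
  | zero => simp
  | succ N ih =>
    rw [Finset.sum_range_succ]
    have h1 : 0 < √((N + 1 : ℕ) : ℝ) := sqrt_pos.2 (by positivity)
    have h2 : √((N + 1 : ℕ) : ℝ) ^ 2 = N + 1 := by rw [sq_sqrt (by positivity)]; push_cast; ring
    have h3 : √(N : ℝ) ^ 2 = N := sq_sqrt (by positivity)
    have h4 : (√((N + 1 : ℕ) : ℝ))⁻¹ ≤ 2 * √((N + 1 : ℕ) : ℝ) - 2 * √N := by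
      rw [inv_le_iff_one_le_mul₀ h1]
      nlinarith [sq_nonneg (√((N + 1 : ℕ) : ℝ) - √N)]
    linarith

lemma sum_Ioo_inv_sqrt_le (N : ℕ) :
    ∑ k ∈ Finset.Ioo (-N : ℤ) N, (√((N - k.natAbs : ℕ) : ℝ))⁻¹ ≤ 4 * √N := by
  refine (sum_Ioo_natAbs_le N (φ := fun l => (√((N - l : ℕ) : ℝ))⁻¹)
    fun l => by positivity).trans ?_
  have h := sum_inv_sqrt_le N
  rw [← Finset.sum_range_reflect] at h
  have : ∑ l ∈ Finset.range N, (√((N - l : ℕ) : ℝ))⁻¹ ≤ 2 * √N := by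
    refine le_of_eq_of_le (Finset.sum_congr rfl fun l hl => ?_) h
    rw [Finset.mem_range] at hl
    rw [show N - l = N - 1 - l + 1 by omega]
  linarith

/-- The time that has passed since the switching of the node `l < N` at the switching time of the
node `N`. -/
lemma exists_gap_bounds (ha : 0 < a) (E : ℝ) :
    ∃ N₀ ≥ 1, ∀ N ≥ N₀, ∀ t : ℕ → ℝ, (∀ k ≤ N, |t k - a * (k : ℝ) ^ 2| ≤ E * √(k : ℝ)) →
      ∀ l < N, a / 2 * N * (N - l : ℕ) ≤ t N - t l ∧
        |t N - t l - a * ((N : ℝ) ^ 2 - (l : ℝ) ^ 2)| ≤ 2 * |E| * √N := by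
  obtain ⟨M, hM⟩ := exists_nat_gt ((4 * |E| / a) ^ 2)
  refine ⟨M + 1, by omega, fun N hN t ht l hl => ?_⟩
  have hNR : (M : ℝ) + 1 ≤ N := by exact_mod_cast hN
  have hN0 : (0 : ℝ) < N := by linarith [M.cast_nonneg (α := ℝ)]
  have hlt : 4 * |E| / a < √N := lt_sqrt_of_sq_lt (by linarith)
  rw [div_lt_iff₀ ha] at hlt
  have hs : 0 < √(N : ℝ) := sqrt_pos.2 hN0
  have h4 : 4 * |E| * √N < a * N := by
    have := mul_lt_mul_of_pos_right hlt hs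
    rwa [mul_right_comm √(N : ℝ), ← sq, sq_sqrt hN0.le, mul_comm (N : ℝ)] at this
  have hlN : (l : ℝ) ≤ N := by exact_mod_cast hl.le
  have e0 : √(l : ℝ) ≤ √N := sqrt_le_sqrt hlN
  have e1 : E * √l ≤ |E| * √N := mul_le_mul (le_abs_self E) e0 (sqrt_nonneg _) (abs_nonneg _)
  have e2 : E * √N ≤ |E| * √N := mul_le_mul_of_nonneg_right (le_abs_self E) hs.le
  have h1 := abs_le.1 (ht l hl.le)
  have h2 := abs_le.1 (ht N le_rfl)
  have h3 : |t N - t l - a * ((N : ℝ) ^ 2 - (l : ℝ) ^ 2)| ≤ 2 * |E| * √N := by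
    rw [abs_le]
    constructor <;> linarith [h1.1, h1.2, h2.1, h2.2]
  refine ⟨?_, h3⟩
  have h5 := (abs_le.1 h3).1
  rw [Nat.cast_sub hl.le]
  have h6 : (1 : ℝ) ≤ N - l := by
    have : (l : ℝ) + 1 ≤ N := by exact_mod_cast hl
    linarith
  have h7 : a * N * (N - l) ≤ a * ((N : ℝ) ^ 2 - (l : ℝ) ^ 2) := by
    rw [mul_assoc]
    gcongr
    nlinarith [l.cast_nonneg (α := ℝ)]
  have h8 : a * N ≤ a * N * (N - l) := le_mul_of_one_le_right (by positivity) h6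
  nlinarith

/-- Eventual convexity of `v_n`. The node `n - 1`, whose distance from the node `n` is bounded,
contributes a term of the order `n^{-3/2}`, which dominates the contribution `O(n^{-2})` of the
distant nodes; all other nodes contribute with the right sign. -/
lemma exists_sum_heatKernelLap_nonpos (ha : 0 < a) (E : ℝ) :
    ∃ τ₀ ≥ 1, ∃ N₀ : ℕ, ∀ N ≥ N₀, ∀ t : ℕ → ℝ,
      (∀ k ≤ N, |t k - a * (k : ℝ) ^ 2| ≤ E * √(k : ℝ)) → ∀ τ, τ₀ ≤ τ → τ ≤ 4 * a * N →
      ∑ k ∈ Finset.Ioo (-(N + 1 : ℕ) : ℤ) (N + 1 : ℕ),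
        heatKernelLap (N + 1 - k) (τ + t N - t k.natAbs) ≤ 0 := by
  obtain ⟨κ, hκ, ρ, hρ, hneg⟩ := exists_heatKernelLap_le
  obtain ⟨N₁, hN₁, hgap⟩ := exists_gap_bounds ha E
  have hρ0 : 0 < ρ := by linarith
  set δ := min (a / (8 * ρ)) 1
  have hδ : 0 < δ := lt_min (by positivity) one_pos
  set C := 64 / (δ ^ 2 * √(a / 2))
  have hsa : 0 < √(a / 2) := sqrt_pos.2 (by positivity)
  have hC : 0 < C := by positivity
  obtain ⟨M, hM⟩ := exists_nat_gt (((4 * C + 64) * (8 * a * √a) / κ) ^ 2)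
  refine ⟨ρ, hρ, max N₁ M + 1, fun N hN t ht τ hτ hτN => ?_⟩
  have hN1 : 1 ≤ N := by omega
  have hNR : (M : ℝ) ≤ N := by
    have : M ≤ N := by omega
    exact_mod_cast this
  have hN0 : (0 : ℝ) < N := by exact_mod_cast hN1
  have hsN : 0 < √(N : ℝ) := sqrt_pos.2 hN0
  have hsN2 : √(N : ℝ) ^ 2 = N := sq_sqrt hN0.le
  have hτ1 : 1 ≤ τ := hρ.trans hτ
  have hτ0 : 0 < τ := by linarith
  have hst : 1 ≤ √τ := one_le_sqrt.2 hτ1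
  rw [sum_Ioo_succ hN1]
  -- the node next to the front
  have hfront : heatKernelLap (N + 1 - (N : ℤ)) (τ + t N - t (N : ℤ).natAbs)
      ≤ -(κ / (8 * a * √a * (N * √N))) := by
    have h1 := hneg 1 τ hτ1 (by linarith)
    rw [Int.natAbs_natCast, add_sub_cancel_right, Int.cast_natCast, add_sub_cancel_left]
    refine h1.trans (neg_le_neg ?_)
    have h2 : √τ ≤ 2 * √a * √N := by
      rw [sqrt_le_left (by positivity), mul_pow, mul_pow, sq_sqrt ha.le, hsN2]
      linarith
    rw [show 8 * a * √a * (N * √N) = (4 * a * N) * (2 * √a * √N) by ring]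
    gcongr
  -- its mirror image
  have hback : heatKernelLap (N + 1 - (-N : ℤ)) (τ + t N - t (-N : ℤ).natAbs)
      ≤ 64 / (N : ℝ) ^ 2 := by
    have h1 := (le_abs_self _).trans (abs_heatKernelLap_le (m := 2 * N + 1) (by omega) hτ0)
    rw [Int.natAbs_neg, Int.natAbs_natCast, add_sub_cancel_right]
    push_cast at h1 ⊢
    rw [show (N : ℝ) + 1 - -N = 2 * N + 1 by ring]
    refine h1.trans ?_
    gcongr
    calc (N : ℝ) ^ 2 = N ^ 2 * 1 := (mul_one _).symm
      _ ≤ (2 * N + 1) ^ 2 * √τ := by gcongr; linarith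
  have hterm : ∀ k ∈ Finset.Ioo (-N : ℤ) N,
      heatKernelLap (N + 1 - k) (τ + t N - t k.natAbs)
        ≤ C / (N ^ 2 * √N) * (√((N - k.natAbs : ℕ) : ℝ))⁻¹ := by
    intro k hk
    rw [Finset.mem_Ioo] at hk
    have hl : k.natAbs < N := by omega
    have hg := (hgap N (by omega) t ht _ hl).1
    set j := N - k.natAbs
    have hj : (1 : ℝ) ≤ (j : ℝ) := by
      have : 1 ≤ j := by omega
      exact_mod_cast this
    obtain ⟨m, hm⟩ := Int.eq_ofNat_of_zero_le (show 0 ≤ N + 1 - k by omega)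
    have hmR : (N : ℝ) + 1 - k = (m : ℝ) := by exact_mod_cast hm
    have hm1 : 1 ≤ m := by omega
    rw [hmR]
    set τ' := τ + t N - t k.natAbs
    have hgpos : 0 < a / 2 * N * (j : ℝ) := by positivity
    have hτ' : a / 2 * N * (j : ℝ) ≤ τ' := by simp only [τ']; linarith
    have hτ'0 : 0 < τ' := hgpos.trans_le hτ'
    have hnn : 0 ≤ C / (N ^ 2 * √N) * (√(j : ℝ))⁻¹ := by positivity
    by_cases hsmall : ρ * (m : ℝ) ^ 2 ≤ τ'
    · have h1 := hneg m τ' (by simp only [τ']; linarith) hsmall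
      have h2 : 0 ≤ κ / (τ' * √τ') := by positivity
      linarith
    · have hmN : δ * N ≤ m := by
        rcases le_or_gt 0 k with hk0 | hk0
        · have hmj : (m : ℝ) ≤ 2 * j := by
            have : m ≤ 2 * j := by omega
            exact_mod_cast this
          have hjm : (j : ℝ) ≤ m := by
            have : j ≤ m := by omega
            exact_mod_cast this
          have h1 : a / 2 * N * (j : ℝ) < ρ * (2 * j) ^ 2 :=
            hτ'.trans_lt ((not_le.1 hsmall).trans_le (by gcongr))
          have h2 : a / (8 * ρ) * N ≤ j := by
            rw [div_mul_eq_mul_div, div_le_iff₀ (by positivity)]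
            by_contra hcon
            push Not at hcon
            nlinarith
          calc δ * N ≤ a / (8 * ρ) * N := by gcongr; exact min_le_left _ _
            _ ≤ _ := h2.trans hjm
        · have : (N : ℝ) ≤ m := by
            have : N ≤ m := by omega
            exact_mod_cast this
          calc δ * N ≤ 1 * N := by gcongr; exact min_le_right _ _
            _ ≤ _ := by rwa [one_mul]
      refine (le_abs_self _).trans ((abs_heatKernelLap_le hm1 hτ'0).trans ?_)
      calc 64 / ((m : ℝ) ^ 2 * √τ') ≤ 64 / ((δ * N) ^ 2 * √(a / 2 * N * j)) := by gcongr
        _ = _ := by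
          rw [sqrt_mul (by positivity), sqrt_mul (by positivity)]
          simp only [C]
          field_simp
  have hsum := Finset.sum_le_sum hterm
  rw [← Finset.mul_sum] at hsum
  have h1 : C / (N ^ 2 * √N) * ∑ k ∈ Finset.Ioo (-N : ℤ) N, (√((N - k.natAbs : ℕ) : ℝ))⁻¹
      ≤ 4 * C / N ^ 2 := by
    calc _ ≤ C / (N ^ 2 * √N) * (4 * √N) := by gcongr; exact sum_Ioo_inv_sqrt_le N
      _ = _ := by field_simp
  have h2 : (4 * C + 64) / (N : ℝ) ^ 2 ≤ κ / (8 * a * √a * (N * √N)) := by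
    have h3 : (4 * C + 64) * (8 * a * √a) / κ ≤ √N := by
      refine (lt_sqrt_of_sq_lt ?_).le
      linarith
    rw [div_le_iff₀ hκ] at h3
    have hsa' : 0 < √a := sqrt_pos.2 ha
    rw [div_le_div_iff₀ (by positivity) (by positivity)]
    calc (4 * C + 64) * (8 * a * √a * (N * √N))
        = (4 * C + 64) * (8 * a * √a) * (N * √N) := by ring
      _ ≤ √N * κ * (N * √N) := by gcongr
      _ = κ * N * √N ^ 2 := by ring
      _ = κ * N ^ 2 := by rw [hsN2]; ring
  have h4 : (4 * C + 64) / (N : ℝ) ^ 2 = 4 * C / N ^ 2 + 64 / N ^ 2 := add_div _ _ _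
  linarith

/-- The contribution of the switched nodes to the slope at the front. -/
lemma exists_sum_heatSource_sub_ge (ha : 0 < a) (E : ℝ) {ε : ℝ} (hε : 0 < ε) :
    ∃ N₀ : ℕ, ∀ N ≥ N₀, ∀ t : ℕ → ℝ, (∀ k ≤ N, |t k - a * (k : ℝ) ^ 2| ≤ E * √(k : ℝ)) →
      -(N * ∫ x in (-1 : ℝ)..1, slopeProfile a x) - ε ≤ ∑ k ∈ Finset.Ioo (-N : ℤ) N,
        (heatSource (N - k + 1) (t N - t k.natAbs)
          - heatSource (N - k - 1) (t N - t k.natAbs)) / 2 := by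
  obtain ⟨N₁, hN₁, hgap⟩ := exists_gap_bounds ha E
  have hsa : 0 < √a := sqrt_pos.2 ha
  set C := 16 * |E| / a + 202 / (a * √a)
  have hC : 0 < C := by positivity
  have hlim : Tendsto (fun N : ℕ => C * ((2 * (1 + log N)) / √N)) atTop (𝓝 0) := by
    have h1 : Tendsto (fun x : ℝ => (2 * (1 + log x)) / √x) atTop (𝓝 0) := by
      have h2 := (isLittleO_log_rpow_atTop (r := 1 / 2) (by norm_num)).tendsto_div_nhds_zero
      simp_rw [← sqrt_eq_rpow] at h2
      have h3 := tendsto_sqrt_atTop.inv_tendsto_atTop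
      have h4 := (h3.add h2).const_mul 2
      rw [add_zero, mul_zero] at h4
      refine h4.congr fun x => ?_
      simp only [Pi.inv_apply]
      ring
    simpa using (h1.comp tendsto_natCast_atTop_atTop).const_mul C
  obtain ⟨M, hM⟩ := eventually_atTop.1 (hlim.eventually_le_const hε)
  refine ⟨max N₁ M, fun N hN t ht => ?_⟩
  have hN1 : 1 ≤ N := by omega
  have hN0 : (0 : ℝ) < N := by exact_mod_cast hN1
  have hsN : 0 < √(N : ℝ) := sqrt_pos.2 hN0
  have hsN2 : √(N : ℝ) ^ 2 = N := sq_sqrt hN0.le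
  have hterm : ∀ k ∈ Finset.Ioo (-N : ℤ) N,
      -slopeProfile a (k / N) - C / √N * ((N - k.natAbs : ℕ) : ℝ)⁻¹
        ≤ (heatSource (N - k + 1) (t N - t k.natAbs)
          - heatSource (N - k - 1) (t N - t k.natAbs)) / 2 := by
    intro k hk
    rw [Finset.mem_Ioo] at hk
    have hl : k.natAbs < N := by omega
    obtain ⟨hg1, hg2⟩ := hgap N (by omega) t ht _ hl
    have hlk : ((k.natAbs : ℕ) : ℝ) ^ 2 = (k : ℝ) ^ 2 := by
      rw [Nat.cast_natAbs, Int.cast_abs, sq_abs]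
    rw [hlk] at hg2
    set j := N - k.natAbs
    have hj : (1 : ℝ) ≤ (j : ℝ) := by
      have : 1 ≤ j := by omega
      exact_mod_cast this
    obtain ⟨m, hm⟩ := Int.eq_ofNat_of_zero_le (show 0 ≤ N - k by omega)
    have hmR : (N : ℝ) - k = (m : ℝ) := by exact_mod_cast hm
    have hm1 : 1 ≤ m := by omega
    have hm2 : (m : ℝ) ≤ 2 * N := by
      have : m ≤ 2 * N := by omega
      exact_mod_cast this
    rw [hmR]
    set r := t N - t k.natAbs
    set s := a * ((N : ℝ) ^ 2 - (k : ℝ) ^ 2)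
    have hjs : a * N * j ≤ s := by
      have h1 : (j : ℝ) = N - |(k : ℝ)| := by
        simp only [j]
        rw [Nat.cast_sub hl.le, Nat.cast_natAbs, Int.cast_abs]
      have h2 : |(k : ℝ)| ≤ N := by linarith
      simp only [s]
      rw [mul_assoc, h1, ← sq_abs (k : ℝ)]
      gcongr
      nlinarith [abs_nonneg (k : ℝ)]
    have hpos : 0 < a * N * j := by positivity
    have hs0 : 0 < s := hpos.trans_le hjs
    have e1 := (abs_le.1 (abs_heatSource_sub_sub_le m (σ := a / 2 * N * j) (by positivity)
      hg1 (by linarith : a / 2 * N * j ≤ s))).1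
    have e2 := halfErf_le_heatSource_sub hm1 hs0
    have e3 : halfErf (m / (2 * √s)) = 1 / 2 - slopeProfile a (k / N) := by
      have h1 : (0 : ℝ) < N + k := by
        have : (0 : ℤ) < N + k := by omega
        exact_mod_cast this
      have hm0 : (0 : ℝ) < m := by exact_mod_cast hm1
      rw [slopeProfile, sub_sub_cancel]
      congr 1
      rw [eq_comm, sqrt_eq_iff_mul_self_eq (by
        rw [show (1 : ℝ) - k / N = m / N by rw [← hmR]; field_simp,
          show (1 : ℝ) + k / N = (N + k) / N by field_simp]
        positivity) (by positivity)]
      rw [← sq, div_pow, mul_pow, sq_sqrt hs0.le]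
      have hs' : s = a * (m * (N + k)) := by simp only [s]; rw [← hmR]; ring
      rw [hs', show (1 : ℝ) - k / N = m / N by rw [← hmR]; field_simp,
          show (1 : ℝ) + k / N = (N + k) / N by field_simp]
      field_simp
      norm_num
    have e4 : 4 / (a / 2 * N * j) * |r - s| ≤ 16 * |E| / a / √N * (j : ℝ)⁻¹ := by
      calc _ ≤ 4 / (a / 2 * N * j) * (2 * |E| * √N) := by gcongr
        _ = 16 * |E| / a / √N * (j : ℝ)⁻¹ := by
          rw [← hsN2, sqrt_sq hsN.le]
          field_simp
          ring
    have e5 : 101 * m / (s * √s) ≤ 202 / (a * √a) / √N * (j : ℝ)⁻¹ := by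
      have h1 : √a * √N ≤ √s := by
        rw [← sqrt_mul ha.le]
        refine sqrt_le_sqrt (le_trans ?_ hjs)
        exact le_mul_of_one_le_right (by positivity) hj
      calc _ ≤ 101 * (2 * N) / ((a * N * j) * (√a * √N)) := by gcongr
        _ = _ := by field_simp; norm_num
    have e6 : C / √N * (j : ℝ)⁻¹ = 16 * |E| / a / √N * (j : ℝ)⁻¹
        + 202 / (a * √a) / √N * (j : ℝ)⁻¹ := by simp only [C]; ring
    linarith
  have hsum := Finset.sum_le_sum hterm
  rw [Finset.sum_sub_distrib, Finset.sum_neg_distrib, ← Finset.mul_sum] at hsum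
  have h1 := sum_slopeProfile_le ha hN1
  have h2 : C / √N * ∑ k ∈ Finset.Ioo (-N : ℤ) N, ((N - k.natAbs : ℕ) : ℝ)⁻¹ ≤ ε := by
    calc _ ≤ C / √N * (2 * (1 + log N)) := by gcongr; exact sum_Ioo_inv_le N
      _ = C * ((2 * (1 + log N)) / √N) := by ring
      _ ≤ ε := hM N (by omega)
  linarith

end

section

/-! ### The next switching moment -/

variable {a c h₁ E : ℝ}

/-- When the node `N` switches, the node `N + 1` lies below the threshold by at least `7 h₁ / 16`.
The limit of this distance is `h₁ / 2`, of which `c` comes from the initial values and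
`(h₁ - 2 c) / 2` from half the sum of the heat kernels. -/
lemma exists_front_le (hh : 0 < h₁) (ha : 0 < a)
    (hK : IntervalIntegrable (profile a) volume (-1) 1)
    (hI : 0 < ∫ x in (-1 : ℝ)..1, profile a x)
    (hroot : h₁ * ∫ x in (-1 : ℝ)..1, profile a x = h₁ - 2 * c) (E : ℝ) :
    ∃ N₀ : ℕ, ∀ N ≥ N₀, ∀ t : ℕ → ℝ, (∀ k ≤ N, |t k - a * (k : ℝ) ^ 2| ≤ E * √(k : ℝ)) →
      (∀ k ≤ N, t k ≤ t N) →
      switchedSolution c h₁ (N + 1) t (N + 1 : ℕ) (t N)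
        ≤ switchedSolution c h₁ (N + 1) t N (t N) - 7 * h₁ / 16 := by
  obtain ⟨N₁, h1⟩ := exists_integral_profile_sub_le_sum ha hK hI E (σ₀ := 0)
    (ε := 1 / 16) (by norm_num)
  obtain ⟨N₂, h2⟩ := exists_sum_heatSource_sub_ge ha E (ε := 1 / 32) (by norm_num)
  refine ⟨max (max N₁ N₂) 1, fun N hN t ht hord => ?_⟩
  have hN1 : 1 ≤ N := by omega
  have e1 := h1 N (by omega) t ht hord 0 zero_le_one 0 (by simp)
  have e2 := h2 N (by omega) t ht
  rw [integral_slopeProfile ha hK] at e2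
  have hstep : ∀ k ∈ Finset.Ioo (-N : ℤ) N,
      heatSource (((N + 1 : ℕ) : ℤ) - k) (max (t N - t k.natAbs) 0)
        - heatSource ((N : ℤ) - k) (max (t N - t k.natAbs) 0)
      = (heatSource (N - k + 1) (t N - t k.natAbs)
          - heatSource (N - k - 1) (t N - t k.natAbs)) / 2
        + heatKernel (N + (0 : ℕ) - k) (0 + t N - t k.natAbs) / 2 := by
    intro k hk
    rw [Finset.mem_Ioo] at hk
    have h3 := heatSource_laplacian (N - k) (t N - t k.natAbs)
    rw [if_neg (by omega)] at h3
    rw [max_eq_left (by linarith [hord k.natAbs (by omega)])]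
    push_cast at h3 ⊢
    rw [add_sub_right_comm, zero_add, add_zero]
    linarith
  have hsum := Finset.sum_congr rfl hstep
  rw [Finset.sum_sub_distrib, Finset.sum_add_distrib, ← Finset.sum_div
    (f := fun k : ℤ => heatKernel (N + (0 : ℕ) - k) (0 + t N - t k.natAbs))] at hsum
  have hend : ∀ j : ℤ, ∑ k ∈ Finset.Ioo (-(N + 1 : ℕ) : ℤ) (N + 1 : ℕ),
      heatSource ((j : ℝ) - k) (max (t N - t k.natAbs) 0)
      = ∑ k ∈ Finset.Ioo (-N : ℤ) N, heatSource ((j : ℝ) - k) (max (t N - t k.natAbs) 0) := by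
    intro j
    rw [sum_Ioo_succ hN1]
    simp
  simp only [switchedSolution]
  rw [hend, hend]
  set I := ∫ x in (-1 : ℝ)..1, profile a x
  set A := ∑ k ∈ Finset.Ioo (-N : ℤ) N, (heatSource (N - k + 1) (t N - t k.natAbs)
          - heatSource (N - k - 1) (t N - t k.natAbs)) / 2
  set B := ∑ k ∈ Finset.Ioo (-N : ℤ) N,
    heatKernel (N + (0 : ℕ) - k) (0 + t N - t k.natAbs)
  have e3 := mul_le_mul_of_nonneg_left e1 hh.le
  have e4 := mul_le_mul_of_nonneg_left e2 hh.le
  have e5 : h₁ * (N * (1 - I)) = N * (2 * c) := by linear_combination -(N : ℝ) * hroot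
  have e6 : (((N + 1 : ℕ) : ℤ) : ℝ) ^ 2 = ((N : ℤ) : ℝ) ^ 2 + 2 * N + 1 := by push_cast; ring
  rw [e6]
  have hsum' := congrArg (h₁ * ·) hsum
  simp only [mul_sub, mul_add] at hsum' e3 e4
  linarith

lemma exists_candidate_bounds (ha : 0 < a) (hE : 0 ≤ E) (τ₀ : ℝ) :
    ∃ N₀ : ℕ, 1 ≤ N₀ ∧ ∀ N ≥ N₀, ∀ r s : ℝ, |r - a * (N : ℝ) ^ 2| ≤ E * √(N : ℝ) →
      |s - a * ((N + 1 : ℕ) : ℝ) ^ 2| ≤ E * √((N + 1 : ℕ) : ℝ) →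
      r + τ₀ < s ∧ s - r ≤ 4 * a * N := by
  obtain ⟨M, hM⟩ := exists_nat_gt ((6 * E / a) ^ 2)
  obtain ⟨M', hM'⟩ := exists_nat_gt (τ₀ / a)
  refine ⟨max M M' + 1, by omega, fun N hN r s hr hs => ?_⟩
  have hN1 : (1 : ℝ) ≤ N := by
    have : 1 ≤ N := by omega
    exact_mod_cast this
  have hNM : (M : ℝ) ≤ N := by
    have : M ≤ N := by omega
    exact_mod_cast this
  have hNM' : (M' : ℝ) ≤ N := by
    have : M' ≤ N := by omega
    exact_mod_cast this
  have hsN : 0 < √(N : ℝ) := sqrt_pos.2 (by linarith)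
  have hlt : 6 * E / a < √N := lt_sqrt_of_sq_lt (by linarith)
  rw [div_lt_iff₀ ha] at hlt hM'
  have h6 : 6 * E * √N < a * N := by
    have := mul_lt_mul_of_pos_right hlt hsN
    rwa [mul_right_comm √(N : ℝ), ← sq, sq_sqrt (by linarith), mul_comm (N : ℝ)] at this
  have h2 : √((N + 1 : ℕ) : ℝ) ≤ 2 * √N := by
    rw [sqrt_le_left (by positivity), mul_pow, sq_sqrt (by linarith)]
    push_cast
    linarith
  have h3 : E * √((N + 1 : ℕ) : ℝ) ≤ E * (2 * √N) := by gcongr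
  have h4 : a * ((N + 1 : ℕ) : ℝ) ^ 2 = a * (N : ℝ) ^ 2 + 2 * (a * N) + a := by push_cast; ring
  have h5 : a ≤ a * N := le_mul_of_one_le_right ha.le hN1
  have h7 : τ₀ < a * N := hM'.trans_le (by rw [mul_comm]; gcongr)
  rw [abs_le] at hr hs
  constructor <;> linarith [hr.1, hr.2, hs.1, hs.2]

/-- The behaviour of `v_n` up to a candidate for its root, for arbitrary switching times. -/
lemma exists_forall_reachesThresholdFirstAt (hc : 0 < c) (hh : 2 * c < h₁) (ha : 0 < a)
    (hE : 0 ≤ E) (hroot : ∫ x in (-1 : ℝ)..1, profile a x = (h₁ - 2 * c) / h₁) :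
    ∃ N₀ : ℕ, ∀ N ≥ N₀, ∀ t : ℕ → ℝ, (∀ k ≤ N, |t k - a * (k : ℝ) ^ 2| ≤ E * √(k : ℝ)) →
      (∀ k ≤ N, t k ≤ t N) → switchedSolution c h₁ (N + 1) t N (t N) = 0 →
      ∀ w : ℝ → ℝ, (∀ s, t N ≤ s → w s = switchedSolution c h₁ (N + 1) t (N + 1 : ℕ) s) →
      ∀ tn, IsCandidate a E (N + 1) (t N) w tn → ReachesThresholdFirstAt h₁ (t N) tn w := by
  have hh0 : 0 < h₁ := by linarith
  have hIpos : 0 < ∫ x in (-1 : ℝ)..1, profile a x := by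
    rw [hroot]
    exact div_pos (by linarith) hh0
  -- the integral of a function that is not integrable would be zero
  have hK : IntervalIntegrable (profile a) volume (-1) 1 := by
    by_contra h
    exact hIpos.ne' (intervalIntegral.integral_undef h)
  have hroot' : h₁ * ∫ x in (-1 : ℝ)..1, profile a x = h₁ - 2 * c := by
    rw [hroot]
    field_simp
  obtain ⟨τ₀, hτ₀, N₁, hconv⟩ := exists_sum_heatKernelLap_nonpos ha E
  have hτ0 : 0 < τ₀ := by linarith
  obtain ⟨N₂, hfront⟩ := exists_front_le hh0 ha hK hIpos hroot' E
  obtain ⟨N₃, hN₃, hbounds⟩ := exists_candidate_bounds ha hE τ₀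
  obtain ⟨N₄, hsmall⟩ := exists_integral_profile_sub_le_sum ha hK hIpos E (σ₀ := τ₀)
    (ε := 1 / (4 * τ₀)) (by positivity)
  refine ⟨max (max N₁ N₂) (max N₃ N₄), fun N hN t ht hord hzero w hw tn htn => ?_⟩
  have hN1 : 1 ≤ N := by omega
  obtain ⟨hs₀, htn4⟩ := hbounds N (by omega) (t N) tn (ht N le_rfl) htn.near
  have hfr := hfront N (by omega) t ht hord
  rw [hzero, zero_sub] at hfr
  set s₀ := t N + τ₀
  set φ : ℝ → ℝ := fun s => -c * (((N + 1 : ℕ) : ℤ) : ℝ) ^ 2 + (h₁ - 2 * c) * s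
    - h₁ * ∑ k ∈ Finset.Ioo (-(N + 1 : ℕ) : ℤ) (N + 1 : ℕ), heatSource (N + 1 - k) (s - t k.natAbs)
  set φ' : ℝ → ℝ := fun s => (h₁ - 2 * c)
    - h₁ * ∑ k ∈ Finset.Ioo (-(N + 1 : ℕ) : ℤ) (N + 1 : ℕ), heatKernel (N + 1 - k) (s - t k.natAbs)
  set φ'' : ℝ → ℝ := fun s =>
    - (h₁ * ∑ k ∈ Finset.Ioo (-(N + 1 : ℕ) : ℤ) (N + 1 : ℕ),
      heatKernelLap (N + 1 - k) (s - t k.natAbs))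
  have hφ : ∀ s, HasDerivAt φ (φ' s) s := fun s => by
    have h1 : ∀ k ∈ Finset.Ioo (-(N + 1 : ℕ) : ℤ) (N + 1 : ℕ), HasDerivAt
        (fun s => heatSource ((N : ℝ) + 1 - k) (s - t k.natAbs))
        (heatKernel (N + 1 - k) (s - t k.natAbs)) s := fun k _ =>
      HasDerivAt.comp_sub_const s _ (hasDerivAt_heatSource _ _)
    refine ((((hasDerivAt_id s).const_mul (h₁ - 2 * c)).const_add _).sub
      ((HasDerivAt.fun_sum h1).const_mul h₁)).congr_deriv ?_
    simp only [φ', mul_one]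
  have hφ' : ∀ s, HasDerivAt φ' (φ'' s) s := fun s => by
    have h1 : ∀ k ∈ Finset.Ioo (-(N + 1 : ℕ) : ℤ) (N + 1 : ℕ), HasDerivAt
        (fun s => heatKernel ((N : ℝ) + 1 - k) (s - t k.natAbs))
        (heatKernelLap (N + 1 - k) (s - t k.natAbs)) s := fun k _ =>
      HasDerivAt.comp_sub_const s _ (hasDerivAt_heatKernel _ _)
    exact ((HasDerivAt.fun_sum h1).const_mul h₁).const_sub _
  have hwφ : ∀ s, t N ≤ s → w s = φ s := fun s hs => by
    rw [hw s hs, switchedSolution]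
    simp only [φ]
    congr 2
    refine Finset.sum_congr rfl fun k hk => ?_
    rw [Finset.mem_Ioo] at hk
    rw [max_eq_left (by linarith [hord k.natAbs (by omega)])]
    push_cast
    rfl
  have hderiv : ∀ s, t N < s → deriv w s = φ' s := fun s hs => by
    have : w =ᶠ[𝓝 s] φ := by
      filter_upwards [Ioi_mem_nhds hs] with r hr using hwφ r (le_of_lt hr)
    rw [this.deriv_eq, (hφ s).deriv]
  have hderiv2 : ∀ s, t N < s → deriv (deriv w) s = φ'' s := fun s hs => by
    have : deriv w =ᶠ[𝓝 s] φ' := by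
      filter_upwards [Ioi_mem_nhds hs] with r hr using hderiv r hr
    rw [this.deriv_eq, (hφ' s).deriv]
  have hslow : ∀ s ∈ Icc (t N) s₀, φ' s ≤ h₁ / (4 * τ₀) := fun s hs => by
    have e1 := hsmall N (by omega) t ht hord 1 le_rfl (s - t N)
      ⟨by linarith [hs.1], by linarith [hs.2, show s₀ = t N + τ₀ from rfl]⟩
    have hnn : ∀ k : ℤ, k.natAbs ≤ N → 0 ≤ heatKernel ((N : ℝ) + 1 - k) (s - t k.natAbs) :=
      fun k hk => by
        have := heatKernel_nonneg (N + 1 - k) (τ := s - t k.natAbs)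
          (by linarith [hord _ hk, hs.1])
        push_cast at this
        exact this
    have e2 : ∑ k ∈ Finset.Ioo (-N : ℤ) N,
        heatKernel (N + (1 : ℕ) - k) (s - t N + t N - t k.natAbs)
        ≤ ∑ k ∈ Finset.Ioo (-(N + 1 : ℕ) : ℤ) (N + 1 : ℕ),
          heatKernel (N + 1 - k) (s - t k.natAbs) := by
      rw [sum_Ioo_succ hN1]
      simp only [sub_add_cancel, Nat.cast_one]
      exact le_add_of_nonneg_left (add_nonneg (hnn _ (by omega)) (hnn _ (by omega)))
    have e3 := mul_le_mul_of_nonneg_left (e1.trans e2) hh0.le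
    rw [mul_sub, hroot', mul_one_div] at e3
    simp only [φ']
    linarith
  have hconvex : ∀ s ∈ Icc s₀ tn, 0 ≤ φ'' s := fun s hs => by
    have e1 := hconv N (by omega) t ht (s - t N)
      (by linarith [hs.1, show s₀ = t N + τ₀ from rfl]) (by linarith [hs.2])
    simp only [sub_add_cancel] at e1
    simp only [φ'']
    rw [← mul_neg]
    exact mul_nonneg hh0.le (by linarith)
  have hneg1 : ∀ s ∈ Icc (t N) s₀, φ s < 0 := fun s hs => by
    have e1 := (convex_Icc (t N) s₀).image_sub_le_mul_sub_of_deriv_le (f := φ)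
      (fun r _ => (hφ r).continuousAt.continuousWithinAt)
      (fun r _ => (hφ r).differentiableAt.differentiableWithinAt)
      (C := h₁ / (4 * τ₀)) (fun r hr => by
        rw [interior_Icc] at hr
        rw [(hφ r).deriv]
        exact hslow r ⟨hr.1.le, hr.2.le⟩) (t N) ⟨le_rfl, by simp only [s₀]; linarith⟩ s hs hs.1
    have e2 : h₁ / (4 * τ₀) * (s - t N) ≤ h₁ / 4 := by
      have : s - t N ≤ τ₀ := by linarith [hs.2, show s₀ = t N + τ₀ from rfl]
      calc _ ≤ h₁ / (4 * τ₀) * τ₀ := by gcongr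
        _ = _ := by field_simp
    rw [← hw (t N) le_rfl, hwφ _ le_rfl] at hfr
    linarith
  have hroot0 : φ tn = 0 := by rw [← hwφ tn htn.after.le, htn.root]
  have hs₀t : t N < s₀ := by simp only [s₀]; linarith
  have hconvOn : ConvexOn ℝ (Icc s₀ tn) φ := by
    refine convexOn_of_deriv2_nonneg (convex_Icc _ _)
      (fun r _ => (hφ r).continuousAt.continuousWithinAt)
      (fun r _ => (hφ r).differentiableAt.differentiableWithinAt) ?_ ?_
    · rw [funext fun r => (hφ r).deriv]
      exact fun r _ => (hφ' r).differentiableAt.differentiableWithinAt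
    · intro r hr
      rw [interior_Icc] at hr
      rw [Function.iterate_succ, Function.iterate_one, Function.comp_apply,
        funext fun r => (hφ r).deriv, (hφ' r).deriv]
      exact hconvex r ⟨hr.1.le, hr.2.le⟩
  have hneg : ∀ s ∈ Ioo (t N) tn, w s < 0 := fun s hs => by
    rw [hwφ s hs.1.le]
    rcases le_or_gt s s₀ with h | h
    · exact hneg1 s ⟨hs.1.le, h⟩
    · by_contra hcon
      have e1 := hconvOn.slope_mono_adjacent (left_mem_Icc.2 hs₀.le) (right_mem_Icc.2 hs₀.le) h hs.2
      have e2 : 0 < (φ s - φ s₀) / (s - s₀) :=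
        div_pos (by linarith [hneg1 s₀ ⟨hs₀t.le, le_rfl⟩]) (by linarith)
      have e3 : (φ tn - φ s) / (tn - s) ≤ 0 :=
        div_nonpos_of_nonpos_of_nonneg (by linarith) (by linarith [hs.2])
      linarith
  refine ⟨hneg, ⟨⟨htn.after, htn.root.ge⟩, fun r hr => ?_⟩, s₀, ⟨hs₀t, hs₀⟩, fun s hs => ?_,
    fun s hs => ?_⟩
  · by_contra hcon
    exact (hneg r ⟨hr.1, not_le.1 hcon⟩).not_ge hr.2
  · rw [hderiv s hs.1, show s₀ - t N = τ₀ by simp only [s₀]; ring]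
    have e1 := mul_le_mul_of_nonneg_right (hslow s ⟨hs.1.le, hs.2⟩) hτ0.le
    have e2 : h₁ / (4 * τ₀) * τ₀ = h₁ / 4 := by field_simp
    linarith
  · rw [hderiv2 s (hs₀t.trans_le hs.1)]
    exact hconvex s hs

end

end Rattling

end

theorem mainTheorem5 (c h₁ a E : ℝ) (hc : 0 < c) (hh : 2 * c < h₁) (ha : 0 < a)
    (ha_root : ∫ x in (-1 : ℝ)..1,
        Real.exp (-(1 - x) / (4 * a * (1 + x))) / √(4 * Real.pi * a * (1 - x ^ 2))
      = (h₁ - 2 * c) / h₁)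
    (hE : 0 < E) :
    ∃ n₀ : ℕ, ∀ n : ℕ, n₀ + 1 ≤ n → ∀ (t : ℕ → ℝ) (u v : ℤ → ℝ → ℝ),
      -- the solution of the problem with hysteresis
      (Rattling.IsHysteresisSolution c h₁ u →
        Rattling.InductiveHypothesis a E u t n →
        Rattling.IsFrozenContinuation
          (fun j => Rattling.hysteresis h₁ (u j) (t (n - 1))) (t (n - 1)) u v →
        (∃ tn, Rattling.IsCandidate a E n (t (n - 1)) (v n) tn) ∧
        ∀ tn, Rattling.IsCandidate a E n (t (n - 1)) (v n) tn →
          Rattling.ReachesThresholdFirstAt h₁ (t (n - 1)) tn (v n)) ∧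
      -- the same `n₀` serves all prescribed switching times with the same bounds
      ((∀ k < n, |t k - a * (k : ℝ) ^ 2| ≤ E * √(k : ℝ)) →
        (∀ k < n, 0 ≤ t k ∧ t k ≤ t (n - 1)) →
        (∀ j : ℤ, u j 0 = -c * (j : ℝ) ^ 2) →
        (∃ S : Finset ℝ,
          Rattling.SolvesLattice (Rattling.prescribedConfig h₁ n t) S 0 (t (n - 1)) u) →
        u ((n - 1 : ℕ) : ℤ) (t (n - 1)) = 0 →
        Rattling.IsFrozenContinuation (Rattling.frozenConfig h₁ n) (t (n - 1)) u v →
        ∀ tn, Rattling.IsCandidate a E n (t (n - 1)) (v n) tn →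
          Rattling.ReachesThresholdFirstAt h₁ (t (n - 1)) tn (v n)) := by
  have hh0 : 0 ≤ h₁ := by linarith
  obtain ⟨n₁, hex⟩ := Rattling.exists_forall_isCandidate hc hh0 ha E
  obtain ⟨n₂, hreach⟩ := Rattling.exists_forall_reachesThresholdFirstAt hc hh ha hE.le ha_root
  obtain ⟨n₃, hn₃, hlt⟩ := Rattling.exists_forall_lt ha E
  refine ⟨max n₁ (max n₂ n₃), fun n hn t u v => ?_⟩
  obtain ⟨N, rfl⟩ : ∃ N, n = N + 1 := ⟨n - 1, by omega⟩
  rw [Nat.add_sub_cancel]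
  have hprescribed : (∀ k < N + 1, |t k - a * (k : ℝ) ^ 2| ≤ E * √(k : ℝ)) →
      (∀ k < N + 1, 0 ≤ t k ∧ t k ≤ t N) → (∀ j : ℤ, u j 0 = -c * (j : ℝ) ^ 2) →
      (∃ S : Finset ℝ,
        Rattling.SolvesLattice (Rattling.prescribedConfig h₁ (N + 1) t) S 0 (t N) u) →
      u N (t N) = 0 →
      Rattling.IsFrozenContinuation (Rattling.frozenConfig h₁ (N + 1)) (t N) u v →
      ∀ tn, Rattling.IsCandidate a E (N + 1) (t N) (v (N + 1 : ℕ)) tn →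
        Rattling.ReachesThresholdFirstAt h₁ (t N) tn (v (N + 1 : ℕ)) := by
    intro hnear hord hu0 ⟨S, hS⟩ hzero hv tn htn
    obtain ⟨hu1, hv1⟩ := Rattling.eq_switchedSolution hc.le hh0 (hord N (by omega)).1 hord hu0 hS hv
    exact hreach N (by omega) t (fun k hk => hnear k (by omega)) (fun k hk => (hord k (by omega)).2)
      (by rw [← hu1, hzero]) _ (hv1 _) tn htn
  refine ⟨fun hu hi hv => ?_, hprescribed⟩
  refine ⟨hex (N + 1) (by omega) t u v hu hi hv, hprescribed hi.near (fun k hk => ?_) hu.initial ?_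
    ?_ ?_⟩
  · refine ⟨(hi.switch k hk).1.1, ?_⟩
    rcases (Nat.lt_succ_iff.1 hk).eq_or_lt with h | h
    · rw [h]
    · exact (hlt N (by omega) k h t (hi.near k hk) (hi.near N (by omega))).le
  · have hpos : 0 < t N := (hi.switch 0 (by omega)).1.1.trans_lt
      (hlt N (by omega) 0 (by omega) t (hi.near 0 (by omega)) (hi.near N (by omega)))
    obtain ⟨S, hS⟩ := hu.solves (t N) hpos
    exact ⟨S, hS.congr fun s hs j => hi.hysteresis_eq hu hc hh0 hs.2.le j⟩
  · refine (hi.switch N (by omega)).eq_zero (hu.continuousOn N) ?_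
    have : (0 : ℝ) < N := by
      have : 0 < N := by omega
      exact_mod_cast this
    rw [hu.initial, Int.cast_natCast]
    nlinarith [pow_pos this 2]
  · have hle : ∀ k < N + 1, t k ≤ t N := fun k hk => by
      rcases (Nat.lt_succ_iff.1 hk).eq_or_lt with h | h
      · rw [h]
      · exact (hlt N (by omega) k h t (hi.near k hk) (hi.near N (by omega))).le
    have hfro : (fun j => Rattling.hysteresis h₁ (u j) (t N)) = Rattling.frozenConfig h₁ (N + 1) :=
      funext fun j => by
        rw [hi.hysteresis_eq hu hc hh0 (s := t N) (by rw [Nat.add_sub_cancel]) j,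
          Rattling.prescribedConfig_eq_frozenConfig hle]
    rw [← hfro]
    exact hv
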